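/- **Conventions.** Let $m>p\ge 2$ and let $\psi:(\mathbb R^m,0)\to(\mathbb R^p,0)$ be a real analytic map germ, not identically zero. Put $V=\psi^{-1}(0)$; let $S_\varepsilon\subset\mathbb R^m$ be the sphere of radius $\varepsilon$ centred at $0$, $K_\varepsilon=S_\varepsilon\cap V$ the link, and $B_\eta$, $\bar B_\eta\subset\mathbb R^p$ the open and closed balls of radius $\eta$ centred at $0$. All fibrations are $C^\infty$ locally trivial. **Proposition 5.3.** Suppose that 1. $\psi$ has an isolated critical value at $0$: all points near $0$ where $d\psi$ is not surjective lie in $V$; 2. for every sufficiently small $\varepsilon>0$ and every sufficiently small $\eta>0$ (depending on $\varepsilon$), the restriction $\psi_|:S_\varepsilon\cap\psi^{-1}(\bar B_\eta\setminus\{0\})\to\bar B_\eta\setminus\{0\}$ is a locally trivial fibration (possibly with empty total space); 3. for every sufficiently small $\varepsilon>0$, the map $\theta=\frac{\psi}{\|\psi\|}:S_\varepsilon\setminus K_\varepsilon\to S^{p-1}$ is a submersion. Then $\psi$ has a strong Milnor fibration, i.e. for every sufficiently small $\varepsilon>0$ the map $\theta=\frac{\psi}{\|\psi\|}$ defines an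 open book decomposition of $S_\varepsilon$ with (possibly singular) binding $K_\varepsilon$, in the following sense: * $\theta:S_\varepsilon\setminus K_\varepsilon\to S^{p-1}$ is a surjective $C^\infty$ locally trivial fibration; * $K_\varepsilon$ is closed and has an open neighbourhood $N$ in $S_\varepsilon$ with a continuous map $h:N\to\mathbb R^p$ such that $h^{-1}(0)=K_\varepsilon$, the restriction $h:N\setminus K_\varepsilon\to B_1\setminus\{0\}$ is a $C^\infty$ locally trivial fibration, surjective if $K_\varepsilon\neq\emptyset$, and $\theta=h/\|h\|$ on $N\setminus K_\varepsilon$. If moreover $\psi_{|S_\varepsilon}$ is a submersion at every point of $K_\varepsilon$, then it is an open book decomposition with smooth binding of codimension $p$: in addition to the above, $K_\varepsilon$ has an open neighbourhood $N$ in $S_\varepsilon$ with a diffeomorphism $N\simeq B_1\times K_\varepsilon$ which sends each $x\in K_\varepsilon$ to $(0,x)$ and under which $\theta_{|N\setminus K_\varepsilon}$ becomes $(s,y)\mapsto s/\|s\|$. -/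

import Mathlib

open Set Filter Topology Metric
open scoped ContDiff

/-! Smooth maps between subsets of Euclidean spaces are taken in the sense of `ContDiffOn ℝ ∞`; on
embedded submanifolds (possibly with boundary), the only sets to which this is applied below, this is
the usual notion of a `C^∞` map. -/

/-- `Φ` and `Ψ` are mutually inverse `C^∞` diffeomorphisms between the subsets `s` and `t`. -/
structure IsDiffeoBetween {E G : Type*} [NormedAddCommGroup E] [NormedSpace ℝ E]
    [NormedAddCommGroup G] [NormedSpace ℝ G]
    (Φ : E → G) (Ψ : G → E) (s : Set E) (t : Set G) : Prop where
  mapsTo : MapsTo Φ s t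
  mapsTo_inv : MapsTo Ψ t s
  invOn : InvOn Ψ Φ s t
  contDiffOn : ContDiffOn ℝ ∞ Φ s
  contDiffOn_inv : ContDiffOn ℝ ∞ Ψ t

/-- `f : M → B` is a `C^∞` locally trivial fibration: every `b ∈ B` has a neighbourhood `B ∩ U` over
which `f` is, up to a diffeomorphism over `B ∩ U`, the projection of `(B ∩ U) × f⁻¹(b)` to its first
factor. (An empty total space, with empty fibres, is allowed here.) -/
structure IsSmoothFibration {E F : Type*} [NormedAddCommGroup E] [NormedSpace ℝ E]
    [NormedAddCommGroup F] [NormedSpace ℝ F] (f : E → F) (M : Set E) (B : Set F) : Prop where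
  mapsTo : MapsTo f M B
  contDiffOn : ContDiffOn ℝ ∞ f M
  locallyTrivial : ∀ b ∈ B, ∃ U : Set F, IsOpen U ∧ b ∈ U ∧
    ∃ (Φ : E → F × E) (Ψ : F × E → E),
      IsDiffeoBetween Φ Ψ (M ∩ f ⁻¹' U) ((B ∩ U) ×ˢ (M ∩ f ⁻¹' {b})) ∧
      ∀ x ∈ M ∩ f ⁻¹' U, (Φ x).1 = f x

/-- The pair `(K, θ)` is a (higher) open book structure on `M`, with possibly singular binding `K`:
`θ` is a `C^∞` locally trivial fibration of `M \ K` onto the unit sphere of `F`, and `K` has an open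
neighbourhood `M ∩ N` in `M` with a map `h` to the unit ball, vanishing exactly on `K`, such that
`h` is a locally trivial fibration of `(M ∩ N) \ K` over the punctured ball and `θ = h / ‖h‖` there. -/
structure IsSingularOpenBook {E F : Type*} [NormedAddCommGroup E] [NormedSpace ℝ E]
    [NormedAddCommGroup F] [NormedSpace ℝ F] (M K : Set E) (θ : E → F) : Prop where
  subset : K ⊆ M
  isClosed : IsClosed K
  fibration : IsSmoothFibration θ (M \ K) (sphere (0 : F) 1)
  surjOn : SurjOn θ (M \ K) (sphere (0 : F) 1)
  nearBinding : ∃ (N : Set E) (h : E → F), IsOpen N ∧ K ⊆ N ∧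
    ContinuousOn h (M ∩ N) ∧ (∀ x ∈ M ∩ N, h x = 0 ↔ x ∈ K) ∧
    IsSmoothFibration h ((M ∩ N) \ K) (ball (0 : F) 1 \ {0}) ∧
    (K.Nonempty → SurjOn h ((M ∩ N) \ K) (ball (0 : F) 1 \ {0})) ∧
    ∀ x ∈ (M ∩ N) \ K, θ x = ‖h x‖⁻¹ • h x

/-- The pair `(K, θ)` is a (higher) open book structure on `M` with smooth binding `K`:
`θ` is a `C^∞` locally trivial fibration of `M \ K` onto the unit sphere of `F`, and `K` has an open
neighbourhood `M ∩ N` in `M` diffeomorphic to `B × K`, where `B` is the open unit ball of `F`, such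
that `K` corresponds to `{0} × K` and `θ` to `(s, y) ↦ s / ‖s‖`. In particular `K` is then a
submanifold of `M` of codimension `dim F`. -/
structure IsOpenBook {E F : Type*} [NormedAddCommGroup E] [NormedSpace ℝ E]
    [NormedAddCommGroup F] [NormedSpace ℝ F] (M K : Set E) (θ : E → F) : Prop where
  subset : K ⊆ M
  isClosed : IsClosed K
  fibration : IsSmoothFibration θ (M \ K) (sphere (0 : F) 1)
  surjOn : SurjOn θ (M \ K) (sphere (0 : F) 1)
  nearBinding : ∃ (N : Set E) (Φ : E → F × E) (Ψ : F × E → E), IsOpen N ∧ K ⊆ N ∧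
    IsDiffeoBetween Φ Ψ (M ∩ N) (ball (0 : F) 1 ×ˢ K) ∧
    (∀ x ∈ K, Φ x = (0, x)) ∧
    ∀ x ∈ (M ∩ N) \ K, θ x = ‖(Φ x).1‖⁻¹ • (Φ x).1

/-- The map `ψ / ‖ψ‖` (meaningful off the zero set of `ψ`). -/
noncomputable def milnorMap {E F : Type*} [NormedAddCommGroup F] [NormedSpace ℝ F]
    (ψ : E → F) (x : E) : F :=
  ‖ψ x‖⁻¹ • ψ x

/-- The link `S_ε ∩ ψ⁻¹(0)`. -/
def link {E F : Type*} [NormedAddCommGroup E] [NormedAddCommGroup F]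
    (ψ : E → F) (ε : ℝ) : Set E :=
  sphere (0 : E) ε ∩ ψ ⁻¹' {0}

/-- The germ of `ψ` at `0` has an isolated critical value at `0`: near the origin, `ψ` vanishes at
every critical point (a point where the derivative is not onto). -/
def HasIsolatedCriticalValue {E F : Type*} [NormedAddCommGroup E] [NormedSpace ℝ E]
    [NormedAddCommGroup F] [NormedSpace ℝ F] (ψ : E → F) : Prop :=
  ∀ᶠ x in 𝓝 (0 : E), ¬ Function.Surjective (fderiv ℝ ψ x) → ψ x = 0

/-- For all small `ε > 0`, the map `ψ / ‖ψ‖` from `S_ε` minus the link to the unit sphere is a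
submersion: its derivative maps the tangent space `x^⊥` of `S_ε` at `x` onto the tangent space of the
unit sphere at the image of `x`. -/
def MilnorMapIsSubmersion {E F : Type*} [NormedAddCommGroup E] [InnerProductSpace ℝ E]
    [NormedAddCommGroup F] [InnerProductSpace ℝ F] (ψ : E → F) : Prop :=
  ∀ᶠ ε in 𝓝[>] (0 : ℝ), ∀ x ∈ sphere (0 : E) ε \ link ψ ε,
    ((ℝ ∙ x)ᗮ).map (fderiv ℝ (milnorMap ψ) x : E →ₗ[ℝ] F) = (ℝ ∙ milnorMap ψ x)ᗮ

/-- For all small `0 < η ≪ ε`, the restriction of `ψ` to `S_ε ∩ ψ⁻¹(B̄_η \ {0})` is a `C^∞` locally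
trivial fibration over `B̄_η \ {0}`. -/
def HasThinTubeFibration {E F : Type*} [NormedAddCommGroup E] [NormedSpace ℝ E]
    [NormedAddCommGroup F] [NormedSpace ℝ F] (ψ : E → F) : Prop :=
  ∀ᶠ ε in 𝓝[>] (0 : ℝ), ∀ᶠ η in 𝓝[>] (0 : ℝ),
    IsSmoothFibration ψ (sphere (0 : E) ε ∩ ψ ⁻¹' (closedBall (0 : F) η \ {0}))
      (closedBall (0 : F) η \ {0})

/-- The restriction of `ψ` to `S_ε` is a submersion at every point of the link (so that the link is
a submanifold of `S_ε`). -/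
def LinkIsRegular {E F : Type*} [NormedAddCommGroup E] [InnerProductSpace ℝ E]
    [NormedAddCommGroup F] [NormedSpace ℝ F] (ψ : E → F) (ε : ℝ) : Prop :=
  ∀ x ∈ link ψ ε, ((ℝ ∙ x)ᗮ).map (fderiv ℝ ψ x : E →ₗ[ℝ] F) = ⊤

/-! The difficulty is the local triviality of `θ = ψ / ‖ψ‖` on `S_ε \ K_ε`. This set need not be
compact, so a submersion is not automatically a fibration: horizontal curves might run into the
link. The thin tube prevents this. A fibration over the closed punctured ball has smooth local
sections, so `ψ` restricted to the sphere is a submersion wherever `0 < ‖ψ‖ < η`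
(`IsSmoothFibration.map_fderiv_eq_top`). There the direction of `ψ` can be changed while one linear
component of `ψ` is held fixed.

Near a unit vector `b`, the sphere is charted by central projection to `b + b^⊥`. The chart is
constant on rays, so `θ` is read off from `ψ` itself. `exists_horizontal_field` patches two lifts
tangent to the spheres: one of the chart value, available wherever `θ` is a submersion, and one of
`ψ`, used where `⟪b, ψ⟫` is small. The result preserves `⟪b, ψ⟫` when it is small, so the curves
stay in a compact set off the link. A conserved quantity `κ` encodes this confinement, and
Ehresmann's argument (`exists_isDiffeoBetween_of_horizontal`) yields the trivialization in
`isSmoothFibration_milnorMap`.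

Surjectivity follows from connectedness of the base, once the total space is nonempty (analyticity).
Near the binding one takes `h = ψ / η`. If the link is regular, the same Ehresmann argument for `ψ`
on a tube, now with compact closure inside the submersion locus, gives the product structure
(`LinkIsRegular.exists_tube`).

Smooth dependence of flows on the initial point comes from the Picard operator on `C([0,1], E)`: it
is smooth, a contraction for short times, and the inverse function theorem applies to the identity
minus it. -/

/-! ### Superposition operators on spaces of continuous maps -/

/-- The continuous linear map sending a continuous family of operators to the operator of pointwise
application on continuous maps. -/
noncomputable def pointwiseApply (I E F : Type*) [TopologicalSpace I] [CompactSpace I]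
    [NormedAddCommGroup E] [NormedSpace ℝ E] [NormedAddCommGroup F] [NormedSpace ℝ F] :
    C(I, E →L[ℝ] F) →L[ℝ] C(I, E) →L[ℝ] C(I, F) :=
  LinearMap.mkContinuous₂
    (LinearMap.mk₂ ℝ (fun (A : C(I, E →L[ℝ] F)) (γ : C(I, E)) => (⟨fun t => A t (γ t), by fun_prop⟩ : C(I, F)))
      (fun A B γ => by ext t; simp) (fun c A γ => by ext t; simp)
      (fun A γ δ => by ext t; simp) (fun c A γ => by ext t; simp)) 1
    (fun A γ => by
      rw [one_mul]
      refine (ContinuousMap.norm_le _ (by positivity)).2 fun t => ?_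
      exact ((A t).le_opNorm _).trans
        (mul_le_mul (A.norm_coe_le_norm t) (γ.norm_coe_le_norm t) (norm_nonneg _) ((norm_nonneg _).trans (A.norm_coe_le_norm t))))

/-- A `C^1` function with compact support is uniformly differentiable. -/
theorem exists_forall_norm_sub_sub_fderiv_le {E F : Type*} [NormedAddCommGroup E] [NormedSpace ℝ E]
    [NormedAddCommGroup F] [NormedSpace ℝ F] {f : E → F} (hf : ContDiff ℝ 1 f)
    (hc : HasCompactSupport f) {c : ℝ} (hcpos : 0 < c) :
    ∃ δ > 0, ∀ x y, ‖y - x‖ < δ → ‖f y - f x - fderiv ℝ f x (y - x)‖ ≤ c * ‖y - x‖ := by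
  have hu : UniformContinuous (fderiv ℝ f) :=
    (hc.fderiv ℝ).uniformContinuous_of_continuous (hf.continuous_fderiv one_ne_zero)
  obtain ⟨δ, hδ, h⟩ := Metric.uniformContinuous_iff.1 hu c hcpos
  refine ⟨δ, hδ, fun x y hxy => ?_⟩
  refine Convex.norm_image_sub_le_of_norm_fderiv_le' (𝕜 := ℝ) (s := ball x δ)
    (fun z _ => (hf.differentiable one_ne_zero) z) (fun z hz => ?_) (convex_ball x δ)
    (mem_ball_self hδ) (by rwa [mem_ball, dist_eq_norm])
  have := h (mem_ball.1 hz)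
  rw [dist_eq_norm] at this
  exact this.le

/-- Differentiability in the sup norm requires a pointwise remainder estimate uniform in the point;
compact support of `f` supplies it. -/
theorem hasFDerivAt_comp_left {I E F : Type*} [TopologicalSpace I] [CompactSpace I]
    [NormedAddCommGroup E] [NormedSpace ℝ E] [NormedAddCommGroup F] [NormedSpace ℝ F]
    (f : C(E, F)) (f' : C(E, E →L[ℝ] F)) (hf : ContDiff ℝ 1 f) (hc : HasCompactSupport f)
    (hf' : ∀ x, f' x = fderiv ℝ f x) (γ : C(I, E)) :
    HasFDerivAt (fun γ : C(I, E) => f.comp γ) (pointwiseApply I E F (f'.comp γ)) γ := by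
  refine HasFDerivAt.of_isLittleO (Asymptotics.isLittleO_iff.2 fun c hcpos => ?_)
  obtain ⟨δ, hδ, h⟩ := exists_forall_norm_sub_sub_fderiv_le hf hc hcpos
  filter_upwards [Metric.ball_mem_nhds γ hδ] with η hη
  rw [mem_ball, dist_eq_norm] at hη
  refine (ContinuousMap.norm_le _ (by positivity)).2 fun t => ?_
  have ht : ‖η t - γ t‖ ≤ ‖η - γ‖ := (η - γ).norm_coe_le_norm t
  have := h (γ t) (η t) (ht.trans_lt hη)
  rw [← hf'] at this
  exact this.trans (by gcongr)

/-- The superposition operator of a smooth function with compact support is smooth. -/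
theorem contDiff_comp_left {I : Type*} {E : Type} [TopologicalSpace I] [CompactSpace I]
    [NormedAddCommGroup E] [NormedSpace ℝ E] (n : ℕ) :
    ∀ {F : Type} [NormedAddCommGroup F] [NormedSpace ℝ F] (f : C(E, F)), ContDiff ℝ ∞ f →
      HasCompactSupport f → ContDiff ℝ n (fun γ : C(I, E) => f.comp γ) := by
  induction n with
  | zero =>
    intro F _ _ f _ _
    exact contDiff_zero.2 (ContinuousMap.continuous_postcomp f)
  | succ n ih =>
    intro F _ _ f hf hc
    have hd := (contDiff_infty_iff_fderiv.1 hf).2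
    -- The derivative is again a superposition operator, now with values in `E →L[ℝ] F`; hence `F`
    -- has to vary in the induction.
    let f' : C(E, E →L[ℝ] F) := ⟨fderiv ℝ f, hd.continuous⟩
    have h1 : ContDiff ℝ n (fun γ : C(I, E) => f'.comp γ) := ih f' hd (hc.fderiv ℝ)
    have h2 : ContDiff ℝ n (fun A => pointwiseApply I E F A) :=
      ContinuousLinearMap.contDiff (𝕜 := ℝ) (E := C(I, E →L[ℝ] F)) (F := C(I, E) →L[ℝ] C(I, F))
        (pointwiseApply I E F)
    push_cast
    exact contDiff_succ_iff_hasFDerivAt.2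
      ⟨fun γ => pointwiseApply I E F (f'.comp γ), h2.comp h1,
        fun γ => hasFDerivAt_comp_left f f' (hf.of_le (by norm_num)) hc (fun _ => rfl) γ⟩

/-! ### Integration on the unit interval -/

/-- The primitive vanishing at `0`, as an operator on continuous paths. -/
noncomputable def pathPrimitive (E : Type*) [NormedAddCommGroup E] [NormedSpace ℝ E] :
    C(unitInterval, E) →L[ℝ] C(unitInterval, E) :=
  LinearMap.mkContinuous
    { toFun := fun γ =>
        ⟨fun t => ∫ s in (0 : ℝ)..t, γ (projIcc 0 1 zero_le_one s), by
          have : Continuous fun s : ℝ => γ (projIcc 0 1 zero_le_one s) :=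
            γ.continuous.comp continuous_projIcc
          exact (intervalIntegral.continuous_primitive
            (fun a b => this.intervalIntegrable a b) 0).comp continuous_subtype_val⟩
      map_add' := fun γ δ => by
        ext t
        have h (γ : C(unitInterval, E)) : Continuous fun s : ℝ => γ (projIcc 0 1 zero_le_one s) :=
            γ.continuous.comp continuous_projIcc
        exact intervalIntegral.integral_add ((h γ).intervalIntegrable _ _)
          ((h δ).intervalIntegrable _ _)
      map_smul' := fun c γ => by
        ext t
        exact intervalIntegral.integral_smul _ _ } 1
    (fun γ => by
      rw [one_mul]
      refine (ContinuousMap.norm_le _ (by positivity)).2 fun t => ?_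
      refine (intervalIntegral.norm_integral_le_of_norm_le_const
        (fun s _ => γ.norm_coe_le_norm _)).trans ?_
      rw [sub_zero, abs_of_nonneg t.2.1]
      exact mul_le_of_le_one_right (norm_nonneg _) t.2.2)

theorem pathPrimitive_apply {E : Type*} [NormedAddCommGroup E] [NormedSpace ℝ E]
    (γ : C(unitInterval, E)) (t : unitInterval) :
    pathPrimitive E γ t = ∫ s in (0 : ℝ)..t, γ (projIcc 0 1 zero_le_one s) := rfl

theorem norm_pathPrimitive_le {E : Type*} [NormedAddCommGroup E] [NormedSpace ℝ E] :
    ‖pathPrimitive E‖ ≤ 1 :=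
  LinearMap.mkContinuous_norm_le _ zero_le_one _

/-! ### Inverses of smooth perturbations of the identity -/

/-- If `g` is smooth and a contraction, then `id - g` has a smooth inverse. -/
theorem exists_contDiff_leftInverse_sub {B : Type*} [NormedAddCommGroup B] [NormedSpace ℝ B]
    [CompleteSpace B] {g : B → B} (hg : ContDiff ℝ ∞ g) {c : NNReal} (hc : c < 1)
    (hl : LipschitzWith c g) :
    ∃ s : B → B, ContDiff ℝ ∞ s ∧ ∀ x, s (x - g x) = x := by
  let G : B → B := fun x => x - g x
  have hG : ApproximatesLinearOn G (ContinuousLinearEquiv.refl ℝ B : B →L[ℝ] B) univ c := by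
    intro x _ y _
    have := hl.dist_le_mul x y
    rw [dist_eq_norm, dist_eq_norm] at this
    convert this using 1
    rw [← norm_neg]
    congr 1
    simp [G]
    abel
  have hc' : Subsingleton B ∨
      c < ‖((ContinuousLinearEquiv.refl ℝ B).symm : B →L[ℝ] B)‖₊⁻¹ := by
    rcases subsingleton_or_nontrivial B with h | h
    · exact Or.inl h
    · refine Or.inr ?_
      have : ‖((ContinuousLinearEquiv.refl ℝ B).symm : B →L[ℝ] B)‖₊ = 1 := by
        have : ((ContinuousLinearEquiv.refl ℝ B).symm : B →L[ℝ] B)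
          = ContinuousLinearMap.id ℝ B := rfl
        rw [this]; ext; simp
      rw [this]; simpa using hc
  let e := hG.toHomeomorph G hc'
  have he : ∀ x, e x = x - g x := fun x => rfl
  refine ⟨e.symm, ?_, fun x => by rw [← he]; exact e.symm_apply_apply x⟩
  rw [contDiff_iff_contDiffAt]
  intro a
  set x := e.symm a with hx
  -- The contraction bound gives `‖g'‖ < 1`, so `1 - g'` is invertible by the Neumann series and the
  -- inverse function theorem applies at every point.
  have hd : HasFDerivAt g (fderiv ℝ g x) x := ((hg.differentiable (by simp)) x).hasFDerivAt
  have hn : ‖fderiv ℝ g x‖ < 1 := (hd.le_of_lipschitz hl).trans_lt (by exact_mod_cast hc)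
  obtain ⟨u, hu⟩ := isUnit_one_sub_of_norm_lt_one hn
  let e' := ContinuousLinearEquiv.unitsEquiv ℝ B u
  have he' : (e' : B →L[ℝ] B) = ContinuousLinearMap.id ℝ B - fderiv ℝ g x := by
    ext v; change u.val v = _; rw [hu]; rfl
  refine OpenPartialHomeomorph.contDiffAt_symm e.toOpenPartialHomeomorph (f₀' := e')
    (mem_univ _) ?_ ?_
  · rw [he']
    exact (hasFDerivAt_id x).sub hd
  · exact (contDiff_id.sub hg).contDiffAt

/-! ### Flows of smooth vector fields with compact support -/

/-- The time-`h` endpoint of integral curves depends smoothly on the starting point, for `h` small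
compared to the Lipschitz constant of the field. -/
theorem exists_contDiff_endpoint_of_small {E : Type} [NormedAddCommGroup E] [NormedSpace ℝ E]
    [CompleteSpace E] {Y : E → E} (hY : ContDiff ℝ ∞ Y) (hc : HasCompactSupport Y) {K : NNReal}
    (hK : LipschitzWith K Y) {h : ℝ} (hh : ‖h‖₊ * K < 1) :
    ∃ T : E → E, ContDiff ℝ ∞ T ∧
      ∀ γ : ℝ → E, (∀ t, HasDerivAt γ (Y (γ t)) t) → γ h = T (γ 0) := by
  let Yc : C(E, E) := ⟨Y, hY.continuous⟩
  -- The Picard operator with time rescaled to `[0,1]`: a solution curve `c` starting at `x`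
  -- satisfies `c - g c = x`, with `x` read as a constant path.
  let g : C(unitInterval, E) → C(unitInterval, E) := fun γ => h • pathPrimitive E (Yc.comp γ)
  have hN : ContDiff ℝ ∞ (fun γ : C(unitInterval, E) => Yc.comp γ) :=
    contDiff_infty.2 fun n => contDiff_comp_left n Yc hY hc
  have hg : ContDiff ℝ ∞ g := ((pathPrimitive E).contDiff.comp hN).const_smul h
  have hl : LipschitzWith (‖h‖₊ * K) g := by
    refine LipschitzWith.of_dist_le_mul fun γ δ => ?_
    have h1 : dist (Yc.comp γ) (Yc.comp δ) ≤ K * dist γ δ :=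
      (ContinuousMap.dist_le (by positivity)).2 fun t =>
        (hK.dist_le_mul _ _).trans (by gcongr; exact ContinuousMap.dist_apply_le_dist t)
    have h2 : dist (pathPrimitive E (Yc.comp γ)) (pathPrimitive E (Yc.comp δ)) ≤
        dist (Yc.comp γ) (Yc.comp δ) := by
      rw [dist_eq_norm, dist_eq_norm, ← map_sub]
      exact ((pathPrimitive E).le_opNorm _).trans
        (mul_le_of_le_one_left (norm_nonneg _) norm_pathPrimitive_le)
    calc dist (g γ) (g δ) = ‖h‖ * dist (pathPrimitive E (Yc.comp γ)) (pathPrimitive E (Yc.comp δ)) :=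
          by rw [dist_eq_norm, dist_eq_norm, ← norm_smul, smul_sub]
      _ ≤ ‖h‖ * (K * dist γ δ) := by gcongr; exact h2.trans h1
      _ = _ := by push_cast; ring
  obtain ⟨s, hs, hinv⟩ := exists_contDiff_leftInverse_sub hg hh hl
  refine ⟨fun x => ContinuousMap.evalCLM ℝ (1 : unitInterval)
    (s (ContinuousLinearMap.const ℝ unitInterval x)), ?_, ?_⟩
  · exact (ContinuousLinearMap.contDiff _).comp (hs.comp (ContinuousLinearMap.contDiff _))
  · intro γ hγ
    have hγc : Continuous γ := continuous_iff_continuousAt.2 fun t => (hγ t).continuousAt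
    let c : C(unitInterval, E) := ⟨fun t => γ (h * t), by fun_prop⟩
    have hcg : c - g c = ContinuousLinearMap.const ℝ unitInterval (γ 0) := by
      ext t
      have hd : ∀ s : ℝ, HasDerivAt (fun s => γ (h * s)) (h • Y (γ (h * s))) s := fun s => by
        have := (hγ (h * s)).scomp s ((hasDerivAt_id s).const_mul h)
        simpa [Function.comp_def] using this
      have hint : ∫ s in (0 : ℝ)..t, h • Y (γ (h * s)) = γ (h * t) - γ (h * 0) :=
        intervalIntegral.integral_eq_sub_of_hasDerivAt (fun s _ => hd s)
          (((hY.continuous.comp (hγc.comp (by fun_prop))).const_smul h).intervalIntegrable _ _)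
      have hpr : ∫ s in (0 : ℝ)..t, (Yc.comp c) (projIcc 0 1 zero_le_one s) =
          ∫ s in (0 : ℝ)..t, Y (γ (h * s)) := by
        refine intervalIntegral.integral_congr fun s hs => ?_
        rw [uIcc_of_le t.2.1] at hs
        have : s ∈ Icc (0 : ℝ) 1 := ⟨hs.1, hs.2.trans t.2.2⟩
        simp [projIcc_of_mem zero_le_one this, Yc, c]
      have : g c t = γ (h * t) - γ 0 := by
        change h • (pathPrimitive E (Yc.comp c)) t = _
        rw [pathPrimitive_apply, hpr, ← intervalIntegral.integral_smul, hint, mul_zero]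
      simp [this, c]
    change γ h = (s (ContinuousLinearMap.const ℝ unitInterval (γ 0))) 1
    rw [← hcg, hinv]
    simp [c]

/-- The field is bounded and globally Lipschitz, so Picard–Lindelöf gives existence on `(-1, 1)`
from every starting point; a uniform existence time lets local curves be continued forever. -/
theorem exists_integralCurve_of_hasCompactSupport {E : Type} [NormedAddCommGroup E]
    [NormedSpace ℝ E] [CompleteSpace E] {Y : E → E} (hY : ContDiff ℝ ∞ Y)
    (hc : HasCompactSupport Y) (x : E) :
    ∃ γ : ℝ → E, γ 0 = x ∧ ∀ t, HasDerivAt γ (Y (γ t)) t := by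
  obtain ⟨K, hK⟩ := hY.lipschitzWith_of_hasCompactSupport hc (by simp)
  obtain ⟨L, hL⟩ := hY.continuous.bounded_above_of_compact_support hc
  have hv : ContMDiff (modelWithCornersSelf ℝ E) (modelWithCornersSelf ℝ E).tangent 1
      (fun x => (⟨x, Y x⟩ : TangentBundle (modelWithCornersSelf ℝ E) E)) :=
    contMDiff_vectorSpace_iff_contDiff.2 (hY.of_le (by norm_num))
  have hloc : ∀ x : E, ∃ γ : ℝ → E, γ 0 = x ∧
      IsMIntegralCurveOn (I := (modelWithCornersSelf ℝ E)) γ Y (Ioo (-1) 1) := by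
    intro x
    have hL0 : 0 ≤ L := (norm_nonneg _).trans (hL x)
    -- The radius `L` is also the speed bound, so a curve cannot leave the ball within unit time.
    have hP : IsPicardLindelof (fun _ => Y) (tmin := -1) (tmax := 1) ⟨0, by simp⟩ x
        ⟨L, hL0⟩ 0 ⟨L, hL0⟩ K :=
      IsPicardLindelof.of_time_independent (fun y _ => hL y) hK.lipschitzOnWith (by simp)
    obtain ⟨γ, h0, hγ⟩ := hP.exists_eq_forall_mem_Icc_hasDerivWithinAt₀
    refine ⟨γ, h0, fun t ht => ?_⟩
    have := ((hγ t (Ioo_subset_Icc_self ht)).hasDerivAt (Icc_mem_nhds ht.1 ht.2))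
    have hF : HasFDerivAt γ ((1 : ℝ →L[ℝ] ℝ).smulRight (Y (γ t))) t := by
      rw [ContinuousLinearMap.smulRight_one_eq_toSpanSingleton]
      exact this.hasFDerivAt
    exact hF.hasMFDerivAt.hasMFDerivWithinAt
  obtain ⟨γ, h0, hγ⟩ := exists_isMIntegralCurve_of_isMIntegralCurveOn hv one_pos hloc x
  refine ⟨γ, h0, fun t => ?_⟩
  have hF : HasFDerivAt γ ((1 : ℝ →L[ℝ] ℝ).smulRight (Y (γ t))) t := (hγ t).hasFDerivAt
  rw [ContinuousLinearMap.smulRight_one_eq_toSpanSingleton] at hF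
  simpa using hF.hasDerivAt

theorem integralCurve_unique {E : Type*} [NormedAddCommGroup E] [NormedSpace ℝ E]
    {Y : E → E} {K : NNReal} (hK : LipschitzWith K Y) {γ δ : ℝ → E}
    (hγ : ∀ t, HasDerivAt γ (Y (γ t)) t) (hδ : ∀ t, HasDerivAt δ (Y (δ t)) t) {t₀ : ℝ}
    (h : γ t₀ = δ t₀) : γ = δ :=
  ODE_solution_unique_univ (v := fun _ => Y) (s := fun _ => univ)
    (fun _ => hK.lipschitzOnWith) (fun t => ⟨hγ t, mem_univ _⟩) (fun t => ⟨hδ t, mem_univ _⟩) h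

/-- A smooth vector field with compact support has a global flow, smooth in the space variable. -/
theorem exists_flow_of_hasCompactSupport {E : Type} [NormedAddCommGroup E]
    [NormedSpace ℝ E] [CompleteSpace E] {Y : E → E} (hY : ContDiff ℝ ∞ Y)
    (hc : HasCompactSupport Y) :
    ∃ φ : ℝ → E → E, (∀ x, φ 0 x = x) ∧ (∀ x t, HasDerivAt (fun t => φ t x) (Y (φ t x)) t) ∧
      ∀ t, ContDiff ℝ ∞ (φ t) := by
  choose γ h0 hγ using exists_integralCurve_of_hasCompactSupport hY hc
  obtain ⟨K, hK⟩ := hY.lipschitzWith_of_hasCompactSupport hc (by simp)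
  refine ⟨fun t x => γ x t, h0, hγ, fun t => ?_⟩
  -- Time `t` is cut into `n` steps short enough for the contraction argument, and the time-`t` map
  -- is the `n`-th iterate.
  obtain ⟨n, hn⟩ := exists_nat_gt (‖t‖₊ * K)
  have hn0 : (n : ℝ) ≠ 0 := by
    rintro h
    rw [Nat.cast_eq_zero.1 h] at hn
    simp at hn
  have hsmall : ‖t / n‖₊ * K < 1 := by
    have hpos : (0 : NNReal) < n := lt_of_le_of_lt zero_le hn
    rw [nnnorm_div, Real.nnnorm_natCast, div_mul_eq_mul_div, div_lt_one hpos]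
    exact hn
  obtain ⟨T, hT, hTγ⟩ := exists_contDiff_endpoint_of_small hY hc hK hsmall
  have key : ∀ k : ℕ, ∀ x, γ x (k * (t / n)) = T^[k] x := by
    intro k
    induction k with
    | zero => intro x; simp [h0]
    | succ k ih =>
      intro x
      have := hTγ (fun s => γ x (s + k * (t / n))) (fun s => (hγ x _).comp_add_const _ _)
      simp only [zero_add] at this
      rw [Function.iterate_succ_apply', ← ih, ← this]
      congr 1; push_cast; ring
  have : (fun x => γ x t) = T^[n] := by
    ext1 x
    rw [← key n x, mul_div_cancel₀ _ hn0]
  change ContDiff ℝ ∞ (fun x => γ x t)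
  rw [this]
  have hit : ∀ k : ℕ, ContDiff ℝ ∞ T^[k] := by
    intro k
    induction k with
    | zero => exact contDiff_id
    | succ k ih => rw [Function.iterate_succ']; exact hT.comp ih
  exact hit n

/-! ### Cutoff of vector fields -/

theorem exists_contDiff_cutoff {E : Type*} [NormedAddCommGroup E] [NormedSpace ℝ E]
    [FiniteDimensional ℝ E] {Z O : Set E} (hZ : IsCompact Z) (hO : IsOpen O) (hZO : Z ⊆ O) :
    ∃ β : E → ℝ, ContDiff ℝ ∞ β ∧ HasCompactSupport β ∧ tsupport β ⊆ O ∧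
      (∀ x ∈ Z, β x = 1) ∧ ∀ x, β x ∈ Icc (0 : ℝ) 1 := by
  obtain ⟨L, hL, hZL, hLO⟩ := exists_compact_between hZ hO hZO
  obtain ⟨β, h1, h2, h3, h4⟩ := exists_contMDiff_zero_iff_one_iff_of_isClosed (n := ⊤)
    (modelWithCornersSelf ℝ E) (isOpen_interior (s := L)).isClosed_compl hZ.isClosed
    (disjoint_left.2 fun x hx hx' => hx (hZL hx'))
  have hz : ∀ x ∉ L, β x = 0 := fun x hx => (h3 x).1 fun h => hx (interior_subset h)
  refine ⟨β, h1.contDiff, HasCompactSupport.intro hL hz, ?_, fun x hx => (h4 x).1 hx,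
    fun x => h2 (mem_range_self x)⟩
  refine (closure_minimal (fun x hx => ?_) hL.isClosed).trans hLO
  by_contra h
  exact hx (hz x h)

theorem contDiff_smul_of_tsupport_subset {E V : Type*} [NormedAddCommGroup E] [NormedSpace ℝ E]
    [NormedAddCommGroup V] [NormedSpace ℝ V] {β : E → ℝ} {X : E → V} {O : Set E} (hO : IsOpen O)
    (hβ : ContDiff ℝ ∞ β) (hs : tsupport β ⊆ O) (hX : ContDiffOn ℝ ∞ X O) :
    ContDiff ℝ ∞ (fun x => β x • X x) := by
  rw [contDiff_iff_contDiffAt]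
  intro x
  by_cases hx : x ∈ O
  · exact hβ.contDiffAt.smul (hX.contDiffAt (hO.mem_nhds hx))
  · have : (fun x => β x • X x) =ᶠ[𝓝 x] fun _ => 0 := by
      filter_upwards [(isClosed_tsupport β).isOpen_compl.mem_nhds fun h => hx (hs h)] with y hy
      rw [image_eq_zero_of_notMem_tsupport hy, zero_smul]
    exact contDiffAt_const.congr_of_eventuallyEq this

/-! ### Horizontal paths -/

/-- `y` is the endpoint at time `1` of an integral curve in `O` of the field `X · w` starting
at `x`. -/
def HorizontallyJoined {E H : Type*} [NormedAddCommGroup E] [NormedSpace ℝ E]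
    [NormedAddCommGroup H] [NormedSpace ℝ H] (O : Set E) (X : E → H →L[ℝ] E) (w : H) (x y : E) :
    Prop :=
  ∃ γ : ℝ → E, γ 0 = x ∧ γ 1 = y ∧
    ∀ t ∈ Icc (0 : ℝ) 1, γ t ∈ O ∧ HasDerivWithinAt γ (X (γ t) w) (Icc 0 1) t

namespace HorizontallyJoined

variable {E H : Type*} [NormedAddCommGroup E] [NormedSpace ℝ E]
  [NormedAddCommGroup H] [NormedSpace ℝ H] {O : Set E} {X : E → H →L[ℝ] E} {w : H} {x y z : E}

theorem symm (h : HorizontallyJoined O X w x y) : HorizontallyJoined O X (-w) y x := by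
  obtain ⟨γ, h0, h1, hγ⟩ := h
  refine ⟨fun t => γ (1 - t), by simpa using h1, by simpa using h0, fun t ht => ?_⟩
  have ht' : 1 - t ∈ Icc (0 : ℝ) 1 := ⟨by linarith [ht.2], by linarith [ht.1]⟩
  obtain ⟨hm, hd⟩ := hγ _ ht'
  refine ⟨hm, ?_⟩
  have hin : HasDerivWithinAt (fun t : ℝ => 1 - t) (-1) (Icc 0 1) t := by
    simpa using (hasDerivWithinAt_id t (Icc 0 1)).const_sub 1
  have := hd.scomp t hin (fun s hs => ⟨by linarith [hs.2], by linarith [hs.1]⟩)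
  simpa [Function.comp_def] using this

theorem refl_zero (hx : x ∈ O) : HorizontallyJoined O X 0 x x :=
  ⟨fun _ => x, rfl, rfl, fun t _ => ⟨hx, by simpa using hasDerivWithinAt_const t (Icc 0 1) x⟩⟩

/-- Both curves have compact image in `O`; cutting the field off around them makes it globally
Lipschitz without changing it along either curve. -/
theorem unique [FiniteDimensional ℝ E] (hO : IsOpen O) (hX : ContDiffOn ℝ ∞ X O)
    (h : HorizontallyJoined O X w x y) (h' : HorizontallyJoined O X w x z) : y = z := by
  obtain ⟨γ, h0, h1, hγ⟩ := h
  obtain ⟨δ, h0', h1', hδ⟩ := h'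
  have cγ : ContinuousOn γ (Icc 0 1) := fun t ht => (hγ t ht).2.continuousWithinAt
  have cδ : ContinuousOn δ (Icc 0 1) := fun t ht => (hδ t ht).2.continuousWithinAt
  obtain ⟨β, hβ, hβc, hβs, hβ1, -⟩ := exists_contDiff_cutoff
    ((isCompact_Icc.image_of_continuousOn cγ).union (isCompact_Icc.image_of_continuousOn cδ)) hO
    (union_subset (by rintro _ ⟨t, ht, rfl⟩; exact (hγ t ht).1)
      (by rintro _ ⟨t, ht, rfl⟩; exact (hδ t ht).1))
  have hs : ContDiff ℝ ∞ (fun x => β x • X x w) :=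
    contDiff_smul_of_tsupport_subset hO hβ hβs (hX.clm_apply contDiffOn_const)
  have hsc : HasCompactSupport (fun x => β x • X x w) := hβc.smul_right
  obtain ⟨K, hK⟩ := hs.lipschitzWith_of_hasCompactSupport hsc (by simp)
  have key := ODE_solution_unique (v := fun _ x => β x • X x w) (a := 0) (b := 1) (fun _ => hK) cγ
    (fun t ht => ?_) cδ (fun t ht => ?_) (h0.trans h0'.symm)
  · rw [← h1, ← h1']
    exact key (right_mem_Icc.2 zero_le_one)
  · have ht' := Ico_subset_Icc_self ht
    simp only [hβ1 _ (Or.inl (mem_image_of_mem γ ht')), one_smul]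
    exact (hγ t ht').2.mono_of_mem_nhdsWithin (Icc_mem_nhdsGE_of_mem ht)
  · have ht' := Ico_subset_Icc_self ht
    simp only [hβ1 _ (Or.inr (mem_image_of_mem δ ht')), one_smul]
    exact (hδ t ht').2.mono_of_mem_nhdsWithin (Icc_mem_nhdsGE_of_mem ht)

end HorizontallyJoined

theorem eq_of_hasDerivAt_zero {F : Type*} [NormedAddCommGroup F] [NormedSpace ℝ F] {f : ℝ → F}
    (hf : ∀ t, HasDerivAt f 0 t) (s t : ℝ) : f s = f t :=
  is_const_of_deriv_eq_zero (fun t => (hf t).differentiableAt) (fun t => (hf t).deriv) s t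

/-- Horizontal lifts of line segments in a ball exist and depend smoothly on the data, as long as
the relevant level sets of a conserved quantity `κ` remain in a compact set `Z`. -/
theorem exists_contDiff_horizontal_transport {E H G : Type} [NormedAddCommGroup E]
    [NormedSpace ℝ E] [FiniteDimensional ℝ E] [NormedAddCommGroup H] [NormedSpace ℝ H]
    [FiniteDimensional ℝ H] [NormedAddCommGroup G] [NormedSpace ℝ G]
    {O Z : Set E} (hO : IsOpen O) {X : E → H →L[ℝ] E} (hX : ContDiffOn ℝ ∞ X O)
    {q : E → H} {κ : E → G} (hq : ∀ x ∈ O, DifferentiableAt ℝ q x)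
    (hκ : ∀ x ∈ O, DifferentiableAt ℝ κ x) (hqX : ∀ x ∈ O, ∀ w, fderiv ℝ q x (X x w) = w)
    (hκX : ∀ x ∈ O, ∀ w, fderiv ℝ κ x (X x w) = 0) {R : ℝ} (hZ : IsCompact Z) (hZO : Z ⊆ O) :
    ∃ T : E × H → E, ContDiff ℝ ∞ T ∧ ∀ x ∈ O, ∀ w,
      (∀ y ∈ O, κ y = κ x → ‖q y‖ < R → y ∈ Z) → ‖q x‖ < R → ‖q x + w‖ < R →
      HorizontallyJoined O X w x (T (x, w)) ∧ T (x, w) ∈ O ∧ κ (T (x, w)) = κ x ∧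
        q (T (x, w)) = q x + w := by
  obtain ⟨β, hβ, hβc, hβs, hβ1, hβI⟩ := exists_contDiff_cutoff hZ hO hZO
  obtain ⟨χ, hχ, hχc, -, hχ1, -⟩ := exists_contDiff_cutoff
    (isCompact_closedBall (0 : H) (R + R)) isOpen_univ (subset_univ _)
  have hβX : ContDiff ℝ ∞ (fun x => β x • X x) := contDiff_smul_of_tsupport_subset hO hβ hβs hX
  -- The direction `w` is carried along as a frozen coordinate, so smoothness of the flow in space
  -- gives joint smoothness in `(x, w)`. The factor `χ` only makes the support compact; `‖w‖ < 2R`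
  -- in all relevant cases.
  let Y : E × H → E × H := fun p => ((β p.1 • X p.1) (χ p.2 • p.2), 0)
  have hY : ContDiff ℝ ∞ Y := by
    refine ContDiff.prodMk ?_ contDiff_const
    exact (hβX.comp contDiff_fst).clm_apply ((hχ.comp contDiff_snd).smul contDiff_snd)
  have hYc : HasCompactSupport Y := by
    refine HasCompactSupport.intro (hβc.isCompact.prod hχc.isCompact) fun p hp => ?_
    rw [mem_prod, not_and_or] at hp
    rcases hp with hp | hp
    · simp [Y, image_eq_zero_of_notMem_tsupport hp]
    · simp [Y, image_eq_zero_of_notMem_tsupport hp]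
  obtain ⟨φ, φ0, hφ, hφs⟩ := exists_flow_of_hasCompactSupport hY hYc
  obtain ⟨K, hK⟩ := hY.lipschitzWith_of_hasCompactSupport hYc (by simp)
  refine ⟨fun p => (φ 1 p).1, contDiff_fst.comp (hφs 1), fun x hx w hZx hqx hqw => ?_⟩
  have hw : χ w = 1 := hχ1 w <| by
    rw [mem_closedBall_zero_iff]
    calc ‖w‖ = ‖(q x + w) - q x‖ := by congr 1; abel
      _ ≤ R + R := (norm_sub_le _ _).trans (add_le_add hqw.le hqx.le)
  set γ : ℝ → E := fun t => (φ t (x, w)).1 with hγdef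
  have hsnd : ∀ t, (φ t (x, w)).2 = w := fun t => by
    have := eq_of_hasDerivAt_zero (f := fun t => (φ t (x, w)).2) (fun t => (hφ (x, w) t).snd) t 0
    simpa [φ0] using this
  have hγ : ∀ t, HasDerivAt γ (β (γ t) • X (γ t) w) t := fun t => by
    have := (hasFDerivAt_fst (𝕜 := ℝ) (p := φ t (x, w))).comp_hasDerivAt t (hφ (x, w) t)
    simpa [Y, hsnd, hw, Function.comp_def] using this
  have hγ0 : γ 0 = x := by simp [γ, φ0]
  -- Points outside `O` are equilibria of the cut-off field, so by uniqueness a curve starting in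
  -- `O` never reaches one.
  have hγO : ∀ t, γ t ∈ O := by
    intro t
    by_contra ht
    have hβ0 : β (γ t) = 0 := image_eq_zero_of_notMem_tsupport fun h => ht (hβs h)
    have hY0 : Y (φ t (x, w)) = 0 := by simp [Y, show β (φ t (x, w)).1 = 0 from hβ0]
    have := integralCurve_unique hK (γ := fun s => φ s (x, w)) (δ := fun _ => φ t (x, w))
      (hφ (x, w)) (fun s => by rw [hY0]; exact hasDerivAt_const s _) (t₀ := t) rfl
    have h0 := congrArg Prod.fst (congrFun this 0)
    rw [φ0] at h0
    exact ht (by simpa [γ, ← h0] using hx)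
  have hκγ : ∀ t, κ (γ t) = κ x := fun t => by
    rw [← hγ0]
    refine eq_of_hasDerivAt_zero (f := fun t => κ (γ t)) (fun t => ?_) t 0
    have := (hκ _ (hγO t)).hasFDerivAt.comp_hasDerivAt t (hγ t)
    simpa [hκX _ (hγO t), Function.comp_def] using this
  have hβγ : Continuous fun t => β (γ t) :=
    hβ.continuous.comp (continuous_iff_continuousAt.2 fun t => (hγ t).continuousAt)
  -- The clock slowed down by the cutoff: `q` moves along the segment by `s t • w`. Since `s` stays
  -- in `[0,1]`, convexity of the ball keeps the curve over it, hence in `Z`, where `β = 1`; so the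
  -- clock was never slowed and `s 1 = 1`.
  set s : ℝ → ℝ := fun t => ∫ u in (0 : ℝ)..t, β (γ u) with hs
  have hqγ : ∀ t, q (γ t) = q x + s t • w := fun t => by
    have := eq_of_hasDerivAt_zero (f := fun t => q (γ t) - s t • w) (fun t => ?_) t 0
    · simp only [hs, intervalIntegral.integral_same, zero_smul, sub_zero, hγ0] at this
      rw [← this]; simp [hs]
    · have h1 := (hq _ (hγO t)).hasFDerivAt.comp_hasDerivAt t (hγ t)
      have h2 : HasDerivAt s (β (γ t)) t :=
        intervalIntegral.integral_hasDerivAt_right (hβγ.intervalIntegrable _ _)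
          (hβγ.stronglyMeasurableAtFilter _ _) hβγ.continuousAt
      have h3 := h1.sub (h2.smul_const w)
      rw [map_smul, hqX _ (hγO t), sub_self] at h3
      exact h3
  have hs01 : ∀ t ∈ Icc (0 : ℝ) 1, s t ∈ Icc (0 : ℝ) 1 := fun t ht => by
    refine ⟨intervalIntegral.integral_nonneg ht.1 fun u _ => (hβI _).1, ?_⟩
    have h1 := intervalIntegral.integral_mono_on (μ := MeasureTheory.volume) ht.1
      (hβγ.intervalIntegrable 0 t) (intervalIntegrable_const (c := (1 : ℝ))) (fun u _ => (hβI _).2)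
    rw [intervalIntegral.integral_const] at h1
    simp only [sub_zero, smul_eq_mul, mul_one] at h1
    exact h1.trans ht.2
  have hγZ : ∀ t ∈ Icc (0 : ℝ) 1, β (γ t) = 1 := fun t ht => by
    refine hβ1 _ (hZx _ (hγO t) (hκγ t) ?_)
    have hconv := (convex_ball (0 : H) R).add_smul_mem (x := q x) (y := w)
      (by simpa using hqx) (by simpa using hqw) (hs01 t ht)
    rw [hqγ]
    simpa using hconv
  have hs1 : s 1 = 1 := by
    have : s 1 = ∫ u in (0 : ℝ)..1, (1 : ℝ) := by
      refine intervalIntegral.integral_congr fun u hu => ?_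
      rw [uIcc_of_le zero_le_one] at hu
      exact hγZ u hu
    simpa using this
  refine ⟨⟨γ, hγ0, rfl, fun t ht => ⟨hγO t, ?_⟩⟩, hγO 1, hκγ 1, ?_⟩
  · have := (hγ t).hasDerivWithinAt (s := Icc 0 1)
    rwa [hγZ t ht, one_smul] at this
  · have := hqγ 1
    rwa [hs1, one_smul] at this

/-- **Ehresmann's theorem over a ball.** A submersion `q` with a smooth horizontal lift `X` that
preserves `κ` is trivial over a ball, on the set `κ ∈ 𝒢`, if the level sets of `κ` over the ball
are relatively compact, locally uniformly. -/
theorem exists_isDiffeoBetween_of_horizontal {E H G : Type} [NormedAddCommGroup E]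
    [NormedSpace ℝ E] [FiniteDimensional ℝ E] [NormedAddCommGroup H] [NormedSpace ℝ H]
    [FiniteDimensional ℝ H] [NormedAddCommGroup G] [NormedSpace ℝ G]
    {O : Set E} (hO : IsOpen O) {X : E → H →L[ℝ] E} (hX : ContDiffOn ℝ ∞ X O)
    {q : E → H} {κ : E → G} (hq : ContDiffOn ℝ ∞ q O)
    (hκ : ∀ x ∈ O, DifferentiableAt ℝ κ x) (hqX : ∀ x ∈ O, ∀ w, fderiv ℝ q x (X x w) = w)
    (hκX : ∀ x ∈ O, ∀ w, fderiv ℝ κ x (X x w) = 0) {R : ℝ} {𝒢 : Set G} {M : Set E}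
    (hM : M = {x ∈ O | κ x ∈ 𝒢 ∧ ‖q x‖ < R})
    (hproper : ∀ x₀ ∈ M, ∃ V ∈ 𝓝 x₀, ∃ Z, IsCompact Z ∧ Z ⊆ O ∧
      ∀ x ∈ M ∩ V, ∀ y ∈ O, κ y = κ x → ‖q y‖ < R → y ∈ Z) :
    ∃ (Φ : E → H × E) (Ψ : H × E → E),
      IsDiffeoBetween Φ Ψ M (ball (0 : H) R ×ˢ (M ∩ q ⁻¹' {0})) ∧
      (∀ x ∈ M, (Φ x).1 = q x) ∧ ∀ x ∈ M, q x = 0 → Φ x = (0, x) := by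
  classical
  -- Transport is defined pointwise by choice. Uniqueness of endpoints makes it agree near each
  -- point with a smooth local transport.
  let T : E × H → E := fun p =>
    if h : ∃ y, HorizontallyJoined O X p.2 p.1 y then h.choose else p.1
  have hT : ∀ {x w y}, HorizontallyJoined O X w x y → T (x, w) = y := by
    intro x w y h
    have hex : ∃ y, HorizontallyJoined O X w x y := ⟨y, h⟩
    have : T (x, w) = hex.choose := dif_pos hex
    rw [this]
    exact hex.choose_spec.unique hO hX h
  have hdiff : ∀ x ∈ O, DifferentiableAt ℝ q x := fun x hx =>
    (hq.contDiffAt (hO.mem_nhds hx)).differentiableAt (by simp)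
  have hloc : ∀ x₀ ∈ M, ∃ V ∈ 𝓝 x₀, ∃ T₀ : E × H → E, ContDiff ℝ ∞ T₀ ∧
      ∀ x ∈ M ∩ V, ∀ w, ‖q x + w‖ < R →
        HorizontallyJoined O X w x (T (x, w)) ∧ T (x, w) = T₀ (x, w) ∧ T (x, w) ∈ M ∧
          q (T (x, w)) = q x + w := by
    intro x₀ hx₀
    obtain ⟨V, hV, Z, hZ, hZO, hVZ⟩ := hproper x₀ hx₀
    obtain ⟨T₀, hT₀, h⟩ :=
      exists_contDiff_horizontal_transport hO hX hdiff hκ hqX hκX hZ hZO (R := R)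
    refine ⟨V, hV, T₀, hT₀, fun x hx w hw => ?_⟩
    have hxM := hx.1
    rw [hM] at hxM
    obtain ⟨h1, h2, h3, h4⟩ := h x hxM.1 w (hVZ x hx) hxM.2.2 hw
    rw [hT h1]
    refine ⟨h1, rfl, ?_, h4⟩
    rw [hM]
    exact ⟨h2, by rw [h3]; exact hxM.2.1, by rw [h4]; exact hw⟩
  have hglob : ∀ x ∈ M, ∀ w, ‖q x + w‖ < R → HorizontallyJoined O X w x (T (x, w)) ∧
      T (x, w) ∈ M ∧ q (T (x, w)) = q x + w := by
    intro x hx w hw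
    obtain ⟨V, hV, T₀, -, h⟩ := hloc x hx
    obtain ⟨h1, -, h3, h4⟩ := h x ⟨hx, mem_of_mem_nhds hV⟩ w hw
    exact ⟨h1, h3, h4⟩
  have hMO : M ⊆ O := by rw [hM]; exact fun x hx => hx.1
  have hMR : ∀ x ∈ M, ‖q x‖ < R := by rw [hM]; exact fun x hx => hx.2.2
  have hqM : ContDiffOn ℝ ∞ q M := hq.mono hMO
  have hneg : ∀ x ∈ M, ‖q x + -q x‖ < R := fun x hx => by
    rw [add_neg_cancel, norm_zero]
    exact (norm_nonneg _).trans_lt (hMR x hx)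
  refine ⟨fun x => (q x, T (x, -q x)), fun p => T (p.2, p.1), ⟨?_, ?_, ⟨?_, ?_⟩, ?_, ?_⟩,
    fun x _ => rfl, fun x hx hqx => ?_⟩
  · intro x hx
    obtain ⟨-, h2, h3⟩ := hglob x hx (-q x) (hneg x hx)
    exact ⟨by simpa using hMR x hx, h2, by simpa using h3⟩
  · rintro ⟨w, y⟩ ⟨hw, hy, hqy⟩
    rw [mem_preimage, mem_singleton_iff] at hqy
    exact (hglob y hy w (by simpa [hqy] using hw)).2.1
  · intro x hx
    obtain ⟨h1, -, -⟩ := hglob x hx (-q x) (hneg x hx)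
    have := h1.symm
    rw [neg_neg] at this
    exact hT this
  · rintro ⟨w, y⟩ ⟨hw, hy, hqy⟩
    rw [mem_preimage, mem_singleton_iff] at hqy
    obtain ⟨h1, h2, h3⟩ := hglob y hy w (by simpa [hqy] using hw)
    rw [hqy, zero_add] at h3
    simp only [h3, Prod.mk.injEq, true_and]
    exact hT h1.symm
  · refine hqM.prodMk fun x₀ hx₀ => ?_
    obtain ⟨V, hV, T₀, hT₀, h⟩ := hloc x₀ hx₀
    have hc : ContDiffWithinAt ℝ ∞ (fun x => T₀ (x, -q x)) M x₀ :=
      hT₀.contDiffAt.comp_contDiffWithinAt x₀ (contDiffWithinAt_id.prodMk (hqM x₀ hx₀).neg)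
    refine hc.congr_of_eventuallyEq_of_mem ?_ hx₀
    filter_upwards [inter_mem_nhdsWithin M hV] with x hx
    exact (h x hx _ (hneg x hx.1)).2.1
  · rintro ⟨w₀, y₀⟩ hp
    obtain ⟨V, hV, T₀, hT₀, h⟩ := hloc y₀ hp.2.1
    have hc : ContDiffWithinAt ℝ ∞ (fun p : H × E => T₀ (p.2, p.1))
        (ball (0 : H) R ×ˢ (M ∩ q ⁻¹' {0})) (w₀, y₀) :=
      (hT₀.comp (contDiff_snd.prodMk contDiff_fst)).contDiffWithinAt
    refine hc.congr_of_eventuallyEq_of_mem ?_ hp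
    have hV' : (Prod.snd ⁻¹' V : Set (H × E)) ∈ 𝓝 (w₀, y₀) :=
      continuousAt_snd.preimage_mem_nhds hV
    filter_upwards [inter_mem_nhdsWithin _ hV'] with p hp'
    have hqy : q p.2 = 0 := hp'.1.2.2
    exact (h p.2 ⟨hp'.1.2.1, hp'.2⟩ p.1 (by simpa [hqy] using hp'.1.1)).2.1
  · have hHJ : HorizontallyJoined O X 0 x x := HorizontallyJoined.refl_zero (hMO hx)
    simp only [hqx, neg_zero, Prod.mk.injEq, true_and]
    exact hT hHJ

/-! ### Smooth right inverses tangent to spheres -/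

/-- `A ↦ A†` as a real continuous linear map. -/
noncomputable def adjointL (E H : Type*) [NormedAddCommGroup E] [InnerProductSpace ℝ E]
    [FiniteDimensional ℝ E] [NormedAddCommGroup H] [InnerProductSpace ℝ H]
    [FiniteDimensional ℝ H] [CompleteSpace E] [CompleteSpace H] :
    (E →L[ℝ] H) →L[ℝ] (H →L[ℝ] E) :=
  LinearMap.toContinuousLinearMap
    { toFun := fun A => ContinuousLinearMap.adjoint A
      map_add' := fun A B => map_add _ A B
      map_smul' := fun c A => by simp }

/-- The orthogonal projection to `x^⊥`, for `x ≠ 0`. -/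
noncomputable def perpProj {E : Type*} [NormedAddCommGroup E] [InnerProductSpace ℝ E] (x : E) :
    E →L[ℝ] E :=
  ContinuousLinearMap.id ℝ E - (‖x‖ ^ 2)⁻¹ • (innerSL ℝ x).smulRight x

theorem perpProj_apply {E : Type*} [NormedAddCommGroup E] [InnerProductSpace ℝ E] (x v : E) :
    perpProj x v = v - (‖x‖ ^ 2)⁻¹ • inner ℝ x v • x := rfl

theorem inner_perpProj {E : Type*} [NormedAddCommGroup E] [InnerProductSpace ℝ E] {x : E}
    (hx : x ≠ 0) (v : E) : inner ℝ x (perpProj x v) = 0 := by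
  have : ‖x‖ ≠ 0 := norm_ne_zero_iff.2 hx
  rw [perpProj_apply, inner_sub_right, inner_smul_right, inner_smul_right,
    real_inner_self_eq_norm_sq]
  field_simp
  ring

theorem perpProj_of_inner_eq_zero {E : Type*} [NormedAddCommGroup E] [InnerProductSpace ℝ E]
    {x v : E} (h : inner ℝ x v = 0) : perpProj x v = v := by
  simp [perpProj_apply, h]

theorem contDiffOn_perpProj {E : Type*} [NormedAddCommGroup E] [InnerProductSpace ℝ E] :
    ContDiffOn ℝ ∞ (perpProj : E → E →L[ℝ] E) {0}ᶜ := by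
  have h1 : ContDiffOn ℝ ∞ (fun x : E => (‖x‖ ^ 2)⁻¹) {0}ᶜ :=
    ContDiffOn.inv (contDiff_norm_sq ℝ).contDiffOn fun x hx =>
      pow_ne_zero 2 (norm_ne_zero_iff.2 hx)
  have h2 : ContDiffOn ℝ ∞ (fun x : E => (innerSL ℝ x).smulRight x) {0}ᶜ :=
    ((innerSL ℝ).contDiff.smulRight contDiff_id).contDiffOn
  exact contDiffOn_const.sub (h1.smul h2)

/-- The kernel of `A A†` is that of `A†`, which is orthogonal to the range of `A`; injectivity
suffices in finite dimension. -/
theorem isUnit_comp_adjoint {E H : Type*} [NormedAddCommGroup E] [InnerProductSpace ℝ E]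
    [NormedAddCommGroup H] [InnerProductSpace ℝ H]
    [FiniteDimensional ℝ H] [CompleteSpace E] [CompleteSpace H] {A : E →L[ℝ] H}
    (hA : Function.Surjective A) : IsUnit (A.comp (ContinuousLinearMap.adjoint A)) := by
  have hinj : Function.Injective (A.comp (ContinuousLinearMap.adjoint A)) := by
    rw [injective_iff_map_eq_zero]
    intro w hw
    have h1 : ContinuousLinearMap.adjoint A w = 0 := by
      rw [← inner_self_eq_zero (𝕜 := ℝ), ContinuousLinearMap.adjoint_inner_left]
      have : A (ContinuousLinearMap.adjoint A w) = 0 := hw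
      rw [this, inner_zero_right]
    obtain ⟨v, rfl⟩ := hA w
    rw [← inner_self_eq_zero (𝕜 := ℝ), ← ContinuousLinearMap.adjoint_inner_left, h1,
      inner_zero_left]
  have hb : Function.Bijective (A.comp (ContinuousLinearMap.adjoint A) : H →ₗ[ℝ] H) :=
    ⟨hinj, LinearMap.injective_iff_surjective.1 hinj⟩
  let e := (LinearEquiv.ofBijective _ hb).toContinuousLinearEquiv
  refine ⟨(ContinuousLinearEquiv.unitsEquiv ℝ H).symm e, ?_⟩
  ext w
  rfl

theorem map_orthogonal_eq_top_iff {E H : Type*} [NormedAddCommGroup E] [InnerProductSpace ℝ E]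
    [NormedAddCommGroup H] [NormedSpace ℝ H] (D : E →L[ℝ] H) {x : E} (hx : x ≠ 0) :
    ((Submodule.span ℝ {x})ᗮ).map (D : E →ₗ[ℝ] H) = ⊤ ↔
      Function.Surjective (D.comp (perpProj x)) := by
  rw [Submodule.eq_top_iff']
  refine ⟨fun h w => ?_, fun h w => ?_⟩
  · obtain ⟨v, hv, rfl⟩ := h w
    refine ⟨v, ?_⟩
    change D (perpProj x v) = D v
    rw [perpProj_of_inner_eq_zero (Submodule.mem_orthogonal_singleton_iff_inner_right.1 hv)]
  · obtain ⟨v, rfl⟩ := h w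
    exact ⟨perpProj x v, Submodule.mem_orthogonal_singleton_iff_inner_right.2
      (inner_perpProj hx v), rfl⟩

/-- The points where `f` restricts to a submersion on the sphere through the point form an open
set, on which there is a smooth right inverse of the derivative tangent to the spheres. -/
theorem exists_tangent_rightInverse {E H : Type*} [NormedAddCommGroup E] [InnerProductSpace ℝ E]
    [FiniteDimensional ℝ E] [NormedAddCommGroup H] [InnerProductSpace ℝ H]
    [FiniteDimensional ℝ H] {f : E → H} {O : Set E} (hO : IsOpen O) (h0 : (0 : E) ∉ O)
    (hf : ContDiffOn ℝ ∞ f O) :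
    IsOpen {x ∈ O | ((Submodule.span ℝ {x})ᗮ).map (fderiv ℝ f x : E →ₗ[ℝ] H) = ⊤} ∧
      ∃ L : E → H →L[ℝ] E,
        ContDiffOn ℝ ∞ L
          {x ∈ O | ((Submodule.span ℝ {x})ᗮ).map (fderiv ℝ f x : E →ₗ[ℝ] H) = ⊤} ∧
        (∀ x ∈ O, ∀ w, inner ℝ x (L x w) = 0) ∧
        ∀ x ∈ O, ((Submodule.span ℝ {x})ᗮ).map (fderiv ℝ f x : E →ₗ[ℝ] H) = ⊤ →
          ∀ w, fderiv ℝ f x (L x w) = w := by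
  have := FiniteDimensional.complete ℝ E
  have := FiniteDimensional.complete ℝ H
  have hne : ∀ x ∈ O, x ≠ 0 := fun x hx h => h0 (h ▸ hx)
  let A : E → E →L[ℝ] H := fun x => (fderiv ℝ f x).comp (perpProj x)
  let A' : E → H →L[ℝ] E := fun x => adjointL E H (A x)
  let B : E → H →L[ℝ] H := fun x => (A x).comp (A' x)
  have hA : ContDiffOn ℝ ∞ A O :=
    (hf.fderiv_of_isOpen hO (by simp)).clm_comp (contDiffOn_perpProj.mono hne)
  have hA' : ContDiffOn ℝ ∞ A' O := (adjointL E H).contDiff.comp_contDiffOn hA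
  have hB : ContDiffOn ℝ ∞ B O := hA.clm_comp hA'
  have hiff : ∀ x ∈ O, ((Submodule.span ℝ {x})ᗮ).map (fderiv ℝ f x : E →ₗ[ℝ] H) = ⊤ ↔
      IsUnit (B x) := by
    intro x hx
    rw [map_orthogonal_eq_top_iff _ (hne x hx)]
    refine ⟨fun h => isUnit_comp_adjoint h, ?_⟩
    rintro ⟨u, hu⟩ w
    refine ⟨A' x (u⁻¹.val w), ?_⟩
    change B x (u⁻¹.val w) = w
    rw [← hu]
    have := congrArg (fun C : H →L[ℝ] H => C w) u.mul_inv
    exact this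
  have hset : {x ∈ O | ((Submodule.span ℝ {x})ᗮ).map (fderiv ℝ f x : E →ₗ[ℝ] H) = ⊤} =
      O ∩ B ⁻¹' {C | IsUnit C} := by
    ext x
    exact and_congr_right fun hx => hiff x hx
  -- With `A = f' P` for the projection `P` to `x^⊥`, the lift is `P A† (A A†)⁻¹`. It is tangent to
  -- the spheres everywhere, and a right inverse where `A A†` is invertible.
  refine ⟨?_, fun x => ((perpProj x).comp (A' x)).comp (Ring.inverse (B x)), ?_, ?_, ?_⟩
  · rw [hset]
    exact hB.continuousOn.isOpen_inter_preimage hO Units.isOpen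
  · rw [hset]
    refine (((contDiffOn_perpProj.mono hne).clm_comp hA').mono inter_subset_left).clm_comp ?_
    rintro x ⟨hx, u, hu⟩
    have h1 : ContDiffAt ℝ ∞ Ring.inverse (B x) := by
      rw [← hu]; exact contDiffAt_ringInverse ℝ u
    exact h1.comp_contDiffWithinAt x ((hB x hx).mono inter_subset_left)
  · intro x hx w
    exact inner_perpProj (hne x hx) _
  · intro x hx h w
    have hu := (hiff x hx).1 h
    change B x (Ring.inverse (B x) w) = w
    exact congrArg (fun C : H →L[ℝ] H => C w) (Ring.mul_inverse_cancel _ hu)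

/-! ### Operations on diffeomorphisms and fibrations -/

theorem IsDiffeoBetween.restrict {E G : Type*} [NormedAddCommGroup E] [NormedSpace ℝ E]
    [NormedAddCommGroup G] [NormedSpace ℝ G] {Φ : E → G} {Ψ : G → E} {s s' : Set E} {t t' : Set G}
    (h : IsDiffeoBetween Φ Ψ s t) (hs : s' ⊆ s) (ht : t' ⊆ t) (h1 : MapsTo Φ s' t')
    (h2 : MapsTo Ψ t' s') : IsDiffeoBetween Φ Ψ s' t' :=
  ⟨h1, h2, h.invOn.mono hs ht, h.contDiffOn.mono hs, h.contDiffOn_inv.mono ht⟩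

theorem IsDiffeoBetween.comp_fst {E H F : Type*} [NormedAddCommGroup E] [NormedSpace ℝ E]
    [NormedAddCommGroup H] [NormedSpace ℝ H] [NormedAddCommGroup F] [NormedSpace ℝ F]
    {Φ : E → H × E} {Ψ : H × E → E} {s K : Set E} {A : Set H} {B : Set F} {e : H → F} {e' : F → H}
    (h : IsDiffeoBetween Φ Ψ s (A ×ˢ K)) (he : IsDiffeoBetween e e' A B) :
    IsDiffeoBetween (fun x => (e (Φ x).1, (Φ x).2)) (fun p => Ψ (e' p.1, p.2)) s (B ×ˢ K) where
  mapsTo x hx := ⟨he.mapsTo (h.mapsTo hx).1, (h.mapsTo hx).2⟩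
  mapsTo_inv p hp := h.mapsTo_inv ⟨he.mapsTo_inv hp.1, hp.2⟩
  invOn := by
    constructor
    · intro x hx
      have h1 := he.invOn.1 (h.mapsTo hx).1
      have h2 := h.invOn.1 hx
      simp only [h1]
      exact h2
    · intro p hp
      have h1 : ((e' p.1, p.2) : H × E) ∈ A ×ˢ K := ⟨he.mapsTo_inv hp.1, hp.2⟩
      have h2 := h.invOn.2 h1
      simp only [h2]
      rw [he.invOn.2 hp.1]
  contDiffOn :=
    (he.contDiffOn.comp (contDiff_fst.comp_contDiffOn h.contDiffOn)
      fun x hx => (h.mapsTo hx).1).prodMk (contDiff_snd.comp_contDiffOn h.contDiffOn)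
  contDiffOn_inv :=
    h.contDiffOn_inv.comp
      ((he.contDiffOn_inv.comp contDiffOn_fst fun p hp => hp.1).prodMk contDiffOn_snd)
      fun p hp => ⟨he.mapsTo_inv hp.1, hp.2⟩

theorem isDiffeoBetween_smul {F : Type*} [NormedAddCommGroup F] [NormedSpace ℝ F] {c : ℝ}
    (hc : c ≠ 0) {A B : Set F} (h : ∀ v, v ∈ A ↔ c • v ∈ B) :
    IsDiffeoBetween (fun v : F => c • v) (fun v => c⁻¹ • v) A B where
  mapsTo v hv := (h v).1 hv
  mapsTo_inv v hv := (h _).2 (by rwa [smul_inv_smul₀ hc])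
  invOn := ⟨fun v _ => inv_smul_smul₀ hc v, fun v _ => smul_inv_smul₀ hc v⟩
  contDiffOn := (contDiff_const_smul c).contDiffOn
  contDiffOn_inv := (contDiff_const_smul c⁻¹).contDiffOn

/-- A nonempty locally trivial fibration over a connected base is surjective. -/
theorem IsSmoothFibration.surjOn {E F : Type*} [NormedAddCommGroup E] [NormedSpace ℝ E]
    [NormedAddCommGroup F] [NormedSpace ℝ F] {f : E → F} {M : Set E} {B : Set F}
    (h : IsSmoothFibration f M B) (hB : IsPreconnected B) (hM : M.Nonempty) : SurjOn f M B := by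
  obtain ⟨x₀, hx₀⟩ := hM
  intro b hb
  -- Whether the fibre is empty is locally constant along the base.
  have key := hB.induction₂ (fun b c => b ∈ f '' M ↔ c ∈ f '' M) (fun b hb => ?_)
    (fun _ _ _ _ _ _ h1 h2 => h1.trans h2) (fun _ _ _ _ h1 => h1.symm) (h.mapsTo hx₀) hb
  · exact key.1 (mem_image_of_mem f hx₀)
  · obtain ⟨U, hU, hbU, Φ, Ψ, hΦ, hfst⟩ := h.locallyTrivial b hb
    filter_upwards [inter_mem_nhdsWithin B (hU.mem_nhds hbU)] with c hc
    have : b ∈ f '' M ↔ c ∈ f '' M := by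
      constructor
      · rintro ⟨x, hx, hxb⟩
        have hp : ((c, x) : F × E) ∈ (B ∩ U) ×ˢ (M ∩ f ⁻¹' {b}) := ⟨hc, hx, hxb⟩
        refine ⟨Ψ (c, x), (hΦ.mapsTo_inv hp).1, ?_⟩
        rw [← hfst _ (hΦ.mapsTo_inv hp), hΦ.invOn.2 hp]
      · rintro ⟨x, hx, rfl⟩
        have := (hΦ.mapsTo ⟨hx, hc.2⟩).2
        exact ⟨_, this.1, this.2⟩
    exact this

/-- Polar coordinates exhibit the set as a continuous image of an interval times the unit sphere,
which is connected in dimension at least two. -/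
theorem isPreconnected_punctured_ball {F : Type*} [NormedAddCommGroup F] [NormedSpace ℝ F]
    (h : 1 < Module.rank ℝ F) : IsPreconnected (ball (0 : F) 1 \ {0}) := by
  have himg : ball (0 : F) 1 \ {0} =
      (fun p : ℝ × F => p.1 • p.2) '' (Ioo (0 : ℝ) 1 ×ˢ sphere (0 : F) 1) := by
    ext v
    constructor
    · rintro ⟨hv, hv0⟩
      have hn : ‖v‖ ≠ 0 := norm_ne_zero_iff.2 hv0
      refine ⟨(‖v‖, ‖v‖⁻¹ • v), ⟨⟨by positivity, by simpa using hv⟩, ?_⟩, ?_⟩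
      · simp [norm_smul, hn]
      · simp [smul_smul, hn]
    · rintro ⟨⟨t, u⟩, ⟨⟨ht0, ht1⟩, hu⟩, rfl⟩
      have hu' : ‖u‖ = 1 := by simpa using hu
      have hu0 : u ≠ 0 := by rintro rfl; simp at hu'
      simp only at ht0 ht1
      simp [norm_smul, hu', abs_of_pos ht0, ht1, ht0.ne', hu0]
  rw [himg]
  exact (isPreconnected_Ioo.prod (isPreconnected_sphere h 0 1)).image _
    (continuous_fst.smul continuous_snd).continuousOn

/-- Restriction and rescaling of a fibration over a punctured closed ball. -/
theorem IsSmoothFibration.rescale {E F : Type*} [NormedAddCommGroup E] [NormedSpace ℝ E]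
    [NormedAddCommGroup F] [NormedSpace ℝ F] {f : E → F} {S : Set E} {η : ℝ} (hη : 0 < η)
    (h : IsSmoothFibration f (S ∩ f ⁻¹' (closedBall (0 : F) η \ {0})) (closedBall (0 : F) η \ {0})) :
    IsSmoothFibration (fun x => η⁻¹ • f x) (S ∩ f ⁻¹' (ball (0 : F) η \ {0}))
      (ball (0 : F) 1 \ {0}) := by
  have hsub : ball (0 : F) η \ {0} ⊆ closedBall (0 : F) η \ {0} :=
    sdiff_subset_sdiff_left ball_subset_closedBall
  have hM : S ∩ f ⁻¹' (ball (0 : F) η \ {0}) ⊆ S ∩ f ⁻¹' (closedBall (0 : F) η \ {0}) :=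
    inter_subset_inter_right S (preimage_mono hsub)
  have hscale : ∀ v : F, v ∈ ball (0 : F) η \ {0} ↔ η⁻¹ • v ∈ ball (0 : F) 1 \ {0} := by
    intro v
    have h1 : ‖η⁻¹ • v‖ < 1 ↔ ‖v‖ < η := by
      rw [norm_smul, norm_inv, Real.norm_of_nonneg hη.le, inv_mul_lt_iff₀ hη, mul_one]
    simp only [Set.mem_sdiff, mem_ball_zero_iff, mem_singleton_iff, h1, smul_eq_zero, inv_eq_zero,
      hη.ne', false_or]
  refine ⟨fun x hx => (hscale _).1 hx.2, (h.contDiffOn.mono hM).const_smul _, fun b hb => ?_⟩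
  have hb' : η • b ∈ ball (0 : F) η \ {0} := by rw [hscale, inv_smul_smul₀ hη.ne']; exact hb
  obtain ⟨U, hU, hbU, Φ, Ψ, hΦ, hfst⟩ := h.locallyTrivial _ (hsub hb')
  have hfib : S ∩ f ⁻¹' (closedBall (0 : F) η \ {0}) ∩ f ⁻¹' {η • b} =
      S ∩ f ⁻¹' (ball (0 : F) η \ {0}) ∩ (fun x => η⁻¹ • f x) ⁻¹' {b} := by
    ext x
    have : f x = η • b ↔ η⁻¹ • f x = b := by
      rw [inv_smul_eq_iff₀ hη.ne']
    simp only [mem_inter_iff, mem_preimage, mem_singleton_iff, ← this]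
    constructor
    · rintro ⟨⟨h1, -⟩, h3⟩
      exact ⟨⟨h1, by rw [h3]; exact hb'⟩, h3⟩
    · rintro ⟨⟨h1, h2⟩, h3⟩
      exact ⟨⟨h1, hsub h2⟩, h3⟩
  rw [hfib] at hΦ
  have hr : IsDiffeoBetween Φ Ψ (S ∩ f ⁻¹' (ball (0 : F) η \ {0}) ∩ f ⁻¹' U)
      (((ball (0 : F) η \ {0}) ∩ U) ×ˢ
        (S ∩ f ⁻¹' (ball (0 : F) η \ {0}) ∩ (fun x => η⁻¹ • f x) ⁻¹' {b})) := by
    have hs := inter_subset_inter_left (f ⁻¹' U) hM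
    have ht := prod_mono_left
      (t := S ∩ f ⁻¹' (ball (0 : F) η \ {0}) ∩ (fun x => η⁻¹ • f x) ⁻¹' {b})
      (inter_subset_inter_left U hsub)
    refine hΦ.restrict hs ht ?_ ?_
    · intro x hx
      refine ⟨?_, (hΦ.mapsTo (hs hx)).2⟩
      rw [hfst x (hs hx)]
      exact ⟨hx.1.2, hx.2⟩
    · intro p hp
      have h1 := hΦ.mapsTo_inv (ht hp)
      have h2 : f (Ψ p) = p.1 := by rw [← hfst _ h1, hΦ.invOn.2 (ht hp)]
      exact ⟨⟨h1.1.1, by rw [mem_preimage, h2]; exact hp.1.1⟩, h1.2⟩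
  have hd := hr.comp_fst (isDiffeoBetween_smul (c := η⁻¹) (inv_ne_zero hη.ne')
    (B := (ball (0 : F) 1 \ {0}) ∩ (fun v => η • v) ⁻¹' U) fun v => by
      simp only [mem_inter_iff, hscale v, mem_preimage, smul_inv_smul₀ hη.ne'])
  have hpre : (fun x => η⁻¹ • f x) ⁻¹' ((fun v => η • v) ⁻¹' U) = f ⁻¹' U := by
    ext x
    simp [smul_inv_smul₀ hη.ne']
  refine ⟨(fun v => η • v) ⁻¹' U, hU.preimage (continuous_const_smul η), hbU, ?_⟩
  rw [hpre]
  refine ⟨_, _, hd, fun x hx => ?_⟩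
  simp only [hfst x ⟨hM hx.1, hx.2⟩]

/-! ### Submersions and tubes -/

/-- A locally trivial fibration is a submersion over the interior of the base. -/
theorem IsSmoothFibration.map_fderiv_eq_top {E F : Type*} [NormedAddCommGroup E]
    [InnerProductSpace ℝ E] [NormedAddCommGroup F] [NormedSpace ℝ F] {f : E → F} {M : Set E}
    {B : Set F} {ε : ℝ} (h : IsSmoothFibration f M B) (hM : M ⊆ sphere (0 : E) ε) {x : E}
    (hx : x ∈ M) (hB : B ∈ 𝓝 (f x)) (hf : DifferentiableAt ℝ f x) :
    ((Submodule.span ℝ {x})ᗮ).map (fderiv ℝ f x : E →ₗ[ℝ] F) = ⊤ := by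
  obtain ⟨U, hU, hbU, Φ, Ψ, hΦ, hfst⟩ := h.locallyTrivial _ (h.mapsTo hx)
  have hBU : B ∩ U ∈ 𝓝 (f x) := inter_mem hB (hU.mem_nhds hbU)
  have hxs : x ∈ M ∩ f ⁻¹' U := ⟨hx, hbU⟩
  have hy := (hΦ.mapsTo hxs).2
  -- A local section through `x`, from the trivialization with the fibre coordinate frozen. It takes
  -- values in the sphere, so its derivative is a right inverse of `f'` tangent to the sphere.
  let σ : F → E := fun b => Ψ (b, (Φ x).2)
  have hσx : σ (f x) = x := by
    change Ψ (f x, (Φ x).2) = x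
    rw [← hfst x hxs]
    exact hΦ.invOn.1 hxs
  have hσd : DifferentiableAt ℝ σ (f x) := by
    have : ContDiffOn ℝ ∞ σ (B ∩ U) :=
      hΦ.contDiffOn_inv.comp (contDiffOn_id.prodMk contDiffOn_const) fun b hb => ⟨hb, hy⟩
    exact (this.contDiffAt hBU).differentiableAt (by simp)
  have hσM : ∀ b ∈ B ∩ U, σ b ∈ M ∧ f (σ b) = b := fun b hb => by
    have hp : ((b, (Φ x).2) : F × E) ∈ (B ∩ U) ×ˢ (M ∩ f ⁻¹' {f x}) := ⟨hb, hy⟩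
    have h1 := hΦ.mapsTo_inv hp
    exact ⟨h1.1, by rw [← hfst _ h1, hΦ.invOn.2 hp]⟩
  have hfσ : HasFDerivAt (fun b => f (σ b)) ((fderiv ℝ f x).comp (fderiv ℝ σ (f x))) (f x) := by
    refine HasFDerivAt.comp (f x) ?_ hσd.hasFDerivAt
    rw [hσx]; exact hf.hasFDerivAt
  have hid : (fderiv ℝ f x).comp (fderiv ℝ σ (f x)) = ContinuousLinearMap.id ℝ F := by
    refine hfσ.unique ((hasFDerivAt_id (f x)).congr_of_eventuallyEq ?_)
    filter_upwards [hBU] with b hb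
    exact (hσM b hb).2
  have horth : ∀ w, inner ℝ x (fderiv ℝ σ (f x) w) = 0 := fun w => by
    have h1 : HasFDerivAt (fun b => ‖σ b‖ ^ 2)
        (2 • (innerSL ℝ (σ (f x))).comp (fderiv ℝ σ (f x))) (f x) := hσd.hasFDerivAt.norm_sq
    have h2 : HasFDerivAt (fun b => ‖σ b‖ ^ 2) (0 : F →L[ℝ] ℝ) (f x) := by
      refine (hasFDerivAt_const (ε ^ 2) (f x)).congr_of_eventuallyEq ?_
      filter_upwards [hBU] with b hb
      rw [mem_sphere_zero_iff_norm.1 (hM (hσM b hb).1)]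
    have h3 := congrArg (fun A : F →L[ℝ] ℝ => A w) (h1.unique h2)
    simpa [hσx] using h3
  rw [Submodule.eq_top_iff']
  intro w
  refine ⟨fderiv ℝ σ (f x) w,
    Submodule.mem_orthogonal_singleton_iff_inner_right.2 (horth w), ?_⟩
  exact congrArg (fun A : F →L[ℝ] F => A w) hid

/-- A smooth link has a trivial tubular neighbourhood. -/
theorem LinkIsRegular.exists_tube {E F : Type} [NormedAddCommGroup E] [InnerProductSpace ℝ E]
    [FiniteDimensional ℝ E] [NormedAddCommGroup F] [InnerProductSpace ℝ F] [FiniteDimensional ℝ F]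
    {ψ : E → F} {r ε : ℝ} (hψ : ContDiffOn ℝ ∞ ψ (ball 0 r)) (hε : 0 < ε) (hεr : ε < r)
    (hreg : LinkIsRegular ψ ε) :
    ∃ η > 0, ∃ (Φ : E → F × E) (Ψ : F × E → E),
      IsDiffeoBetween Φ Ψ (sphere (0 : E) ε ∩ {x | ‖ψ x‖ < η}) (ball (0 : F) 1 ×ˢ link ψ ε) ∧
      (∀ x ∈ sphere (0 : E) ε ∩ {x | ‖ψ x‖ < η}, (Φ x).1 = η⁻¹ • ψ x) ∧
      ∀ x ∈ link ψ ε, Φ x = (0, x) := by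
  have hball : IsOpen (ball (0 : E) r \ {0}) := isOpen_ball.sdiff isClosed_singleton
  obtain ⟨hO, L, hL, hLx, hLψ⟩ := exists_tangent_rightInverse hball (by simp)
    (hψ.mono sdiff_subset)
  set O := {x ∈ ball (0 : E) r \ {0} |
    ((Submodule.span ℝ {x})ᗮ).map (fderiv ℝ ψ x : E →ₗ[ℝ] F) = ⊤} with hOdef
  have hS : sphere (0 : E) ε ⊆ ball (0 : E) r \ {0} := fun x hx => by
    rw [mem_sphere_zero_iff_norm] at hx
    refine ⟨by rw [mem_ball_zero_iff, hx]; exact hεr, ?_⟩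
    rintro rfl
    rw [norm_zero] at hx
    exact hε.ne hx
  have hψS : ContinuousOn ψ (sphere (0 : E) ε) := hψ.continuousOn.mono (hS.trans sdiff_subset)
  have hcomp : IsCompact (sphere (0 : E) ε) := isCompact_sphere 0 ε
  -- On the compact part of the sphere outside the submersion locus, `‖ψ‖` has a positive lower
  -- bound; half of it works even for the closed tube, which is needed for compactness below.
  obtain ⟨η, hη, hηO⟩ : ∃ η > 0, ∀ x ∈ sphere (0 : E) ε, ‖ψ x‖ ≤ η → x ∈ O := by
    obtain ⟨a, ha, h⟩ := (hcomp.diff hO).exists_forall_le' (f := fun x => ‖ψ x‖) (a := 0)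
      (hψS.norm.mono sdiff_subset) fun x hx => by
        rw [norm_pos_iff]
        intro h0
        exact hx.2 ⟨hS hx.1, hreg x ⟨hx.1, h0⟩⟩
    refine ⟨a / 2, half_pos ha, fun x hx hxa => ?_⟩
    by_contra hxO
    linarith [h x ⟨hx, hxO⟩]
  have hM : sphere (0 : E) ε ∩ {x | ‖ψ x‖ < η} =
      {x ∈ O | ‖x‖ ^ 2 ∈ ({ε ^ 2} : Set ℝ) ∧ ‖ψ x‖ < η} := by
    ext x
    constructor
    · rintro ⟨hx, hxη⟩
      exact ⟨hηO x hx (le_of_lt hxη), by rw [mem_sphere_zero_iff_norm.1 hx]; rfl, hxη⟩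
    · rintro ⟨-, hx, hxη⟩
      refine ⟨?_, hxη⟩
      rw [mem_sphere_zero_iff_norm]
      exact (pow_left_inj₀ (norm_nonneg _) hε.le two_ne_zero).1 hx
  have hdκ : ∀ x : E, HasFDerivAt (fun x : E => ‖x‖ ^ 2) (2 • innerSL ℝ x) x := fun x => by
    simpa using (hasFDerivAt_id x).norm_sq
  have hproper : ∀ x₀ ∈ sphere (0 : E) ε ∩ {x | ‖ψ x‖ < η}, ∃ V ∈ 𝓝 x₀, ∃ Z, IsCompact Z ∧ Z ⊆ O ∧
      ∀ x ∈ (sphere (0 : E) ε ∩ {x | ‖ψ x‖ < η}) ∩ V, ∀ y ∈ O,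
        ‖y‖ ^ 2 = ‖x‖ ^ 2 → ‖ψ y‖ < η → y ∈ Z := by
    refine fun x₀ _ => ⟨univ, univ_mem, sphere 0 ε ∩ {x | ‖ψ x‖ ≤ η}, ?_, ?_, ?_⟩
    · exact hcomp.of_isClosed_subset (hψS.norm.preimage_isClosed_of_isClosed hcomp.isClosed
        isClosed_Iic) inter_subset_left
    · rintro x ⟨hx, hxη⟩
      exact hηO x hx hxη
    · intro x hx y hy hxy hyη
      refine ⟨?_, le_of_lt hyη⟩
      have := mem_sphere_zero_iff_norm.1 hx.1.1
      rw [this] at hxy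
      rw [mem_sphere_zero_iff_norm]
      exact (pow_left_inj₀ (norm_nonneg _) hε.le two_ne_zero).1 hxy
  obtain ⟨Φ, Ψ, hΦ, hfst, hzero⟩ := exists_isDiffeoBetween_of_horizontal hO hL
    (hψ.mono fun x hx => hx.1.1) (κ := fun x : E => ‖x‖ ^ 2)
    (fun x _ => (hdκ x).differentiableAt)
    (fun x hx w => hLψ x hx.1 hx.2 w)
    (fun x hx w => by rw [(hdκ x).fderiv]; simp [hLx x hx.1 w]) hM
    hproper
  have hK : sphere (0 : E) ε ∩ {x | ‖ψ x‖ < η} ∩ ψ ⁻¹' {0} = link ψ ε := by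
    ext x
    constructor
    · rintro ⟨⟨h1, -⟩, h2⟩
      exact ⟨h1, h2⟩
    · rintro ⟨h1, h2⟩
      refine ⟨⟨h1, ?_⟩, h2⟩
      rw [mem_preimage, mem_singleton_iff] at h2
      simpa [h2] using hη
  rw [hK] at hΦ
  refine ⟨η, hη, _, _, hΦ.comp_fst (isDiffeoBetween_smul (c := η⁻¹) (inv_ne_zero hη.ne')
    fun v => ?_), fun x hx => ?_, fun x hx => ?_⟩
  · rw [mem_ball_zero_iff, mem_ball_zero_iff, norm_smul, norm_inv, Real.norm_of_nonneg hη.le,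
      inv_mul_lt_iff₀ hη, mul_one]
  · simp only [hfst x hx]
  · rw [← hK] at hx
    simp [hzero x hx.1 hx.2]

/-! ### Nonvanishing on small spheres -/

/-- Along the segment from `0` to a point where `ψ ≠ 0`, the zeros of `ψ` cannot accumulate at `0`
by the identity theorem; yet each sphere on which `ψ` vanishes contributes one. -/
theorem eventually_exists_sphere_ne_zero {E F : Type*} [NormedAddCommGroup E] [NormedSpace ℝ E]
    [NormedAddCommGroup F] [NormedSpace ℝ F] [CompleteSpace F] {ψ : E → F} (hψ : AnalyticAt ℝ ψ 0)
    (hψ0 : ψ 0 = 0) (hne : ∃ᶠ x in 𝓝 (0 : E), ψ x ≠ 0) :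
    ∀ᶠ ε in 𝓝[>] (0 : ℝ), ∃ x ∈ sphere (0 : E) ε, ψ x ≠ 0 := by
  obtain ⟨r, hr, hA⟩ := Metric.eventually_nhds_iff_ball.1 hψ.eventually_analyticAt
  obtain ⟨x, hx0, hxr⟩ := (hne.and_eventually (ball_mem_nhds (0 : E) hr)).exists
  have hx : x ≠ 0 := by rintro rfl; exact hx0 hψ0
  have hn : ‖x‖ ≠ 0 := norm_ne_zero_iff.2 hx
  set v := ‖x‖⁻¹ • x with hv
  have hvn : ‖v‖ = 1 := by simp [hv, norm_smul, hn]
  by_contra hcon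
  rw [not_eventually] at hcon
  have hg : AnalyticOnNhd ℝ (fun t : ℝ => ψ (t • v)) (Icc 0 ‖x‖) := by
    intro t ht
    refine AnalyticAt.fun_comp (hA _ ?_) (by fun_prop)
    rw [mem_ball_zero_iff, norm_smul, hvn, mul_one, Real.norm_of_nonneg ht.1]
    exact ht.2.trans_lt (mem_ball_zero_iff.1 hxr)
  have hfreq : ∃ᶠ t in 𝓝[≠] (0 : ℝ), ψ (t • v) = 0 := by
    have h1 := hcon.and_eventually self_mem_nhdsWithin
    refine (h1.filter_mono (nhdsWithin_mono 0 fun t ht => ne_of_gt ht)).mono ?_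
    rintro t ⟨h2, ht⟩
    by_contra h3
    refine h2 ⟨t • v, ?_, h3⟩
    rw [mem_sphere_zero_iff_norm, norm_smul, hvn, mul_one, Real.norm_of_nonneg (le_of_lt ht)]
  have := hg.eqOn_zero_of_preconnected_of_frequently_eq_zero isPreconnected_Icc
    (left_mem_Icc.2 (norm_nonneg _)) hfreq (right_mem_Icc.2 (norm_nonneg _))
  simp only [hv, smul_inv_smul₀ hn, Pi.zero_apply] at this
  exact hx0 this

/-- On a connected set, a continuous map with a zero which is not identically zero takes
arbitrarily small nonzero values. -/
theorem IsPreconnected.exists_norm_lt_ne_zero {E F : Type*} [TopologicalSpace E]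
    [NormedAddCommGroup F] {ψ : E → F} {S : Set E} (hS : IsPreconnected S) (hψ : ContinuousOn ψ S)
    {x y : E} (hx : x ∈ S) (hy : y ∈ S) (hx0 : ψ x = 0) (hy0 : ψ y ≠ 0) {η : ℝ} (hη : 0 < η) :
    ∃ z ∈ S, ψ z ≠ 0 ∧ ‖ψ z‖ < η := by
  have hy' : 0 < ‖ψ y‖ := norm_pos_iff.2 hy0
  have hmem : min (‖ψ y‖) (η / 2) ∈ Icc ‖ψ x‖ ‖ψ y‖ := by
    rw [hx0, norm_zero]
    exact ⟨le_min hy'.le (half_pos hη).le, min_le_left _ _⟩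
  obtain ⟨z, hz, hzv⟩ := hS.intermediate_value hx hy hψ.norm hmem
  have hpos : 0 < ‖ψ z‖ := by
    simp only at hzv
    rw [hzv]; exact lt_min hy' (half_pos hη)
  refine ⟨z, hz, norm_pos_iff.1 hpos, ?_⟩
  simp only at hzv
  rw [hzv]
  exact (min_le_right _ _).trans_lt (half_lt_self hη)

/-! ### Central projection of a hemisphere -/

section CentralChart

variable {F : Type*} [NormedAddCommGroup F] [InnerProductSpace ℝ F] {b : F}

/-- The component of a vector orthogonal to the unit vector `b`. -/
noncomputable def perpPart (b : F) (hb : ‖b‖ = 1) : F →L[ℝ] (Submodule.span ℝ {b})ᗮ :=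
  (ContinuousLinearMap.id ℝ F - (innerSL ℝ b).smulRight b).codRestrict (Submodule.span ℝ {b})ᗮ
    fun v => Submodule.mem_orthogonal_singleton_iff_inner_right.2 <| by
      simp [inner_sub_right, inner_smul_right, hb]

theorem coe_perpPart (hb : ‖b‖ = 1) (v : F) : (perpPart b hb v : F) = v - inner ℝ b v • b := rfl

theorem inner_coe_orthogonal (w : (Submodule.span ℝ {b})ᗮ) : inner ℝ b (w : F) = 0 :=
  Submodule.mem_orthogonal_singleton_iff_inner_right.1 w.2

theorem perpPart_coe (hb : ‖b‖ = 1) (w : (Submodule.span ℝ {b})ᗮ) : perpPart b hb (w : F) = w := by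
  ext
  rw [coe_perpPart, inner_coe_orthogonal, zero_smul, sub_zero]

theorem perpPart_self (hb : ‖b‖ = 1) : perpPart b hb b = 0 := by
  ext
  simp [coe_perpPart, hb]

/-- The central projection to the affine hyperplane `b + b^⊥`. -/
noncomputable def centralChart (b : F) (hb : ‖b‖ = 1) (v : F) : (Submodule.span ℝ {b})ᗮ :=
  (inner ℝ b v)⁻¹ • perpPart b hb v

/-- The radial projection of the affine hyperplane `b + b^⊥` to the unit sphere. -/
noncomputable def centralChartInv (b : F) (w : (Submodule.span ℝ {b})ᗮ) : F :=
  ‖b + w‖⁻¹ • (b + w)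

/-- Constancy on rays allows the chart to be applied to `ψ` in place of `ψ / ‖ψ‖`. -/
theorem centralChart_smul (hb : ‖b‖ = 1) {t : ℝ} (ht : t ≠ 0) (v : F) :
    centralChart b hb (t • v) = centralChart b hb v := by
  simp only [centralChart, inner_smul_right, map_smul, smul_smul, mul_inv]
  congr 1
  field_simp

theorem centralChart_self (hb : ‖b‖ = 1) : centralChart b hb b = 0 := by
  rw [centralChart, perpPart_self, smul_zero]

theorem inner_add_coe (hb : ‖b‖ = 1) (w : (Submodule.span ℝ {b})ᗮ) : inner ℝ b (b + w : F) = 1 := by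
  rw [inner_add_right, inner_coe_orthogonal, real_inner_self_eq_norm_sq, hb]; norm_num

theorem add_coe_ne_zero (hb : ‖b‖ = 1) (w : (Submodule.span ℝ {b})ᗮ) : (b + w : F) ≠ 0 := by
  intro h
  have := inner_add_coe hb w
  rw [h, inner_zero_right] at this
  exact zero_ne_one this

theorem norm_centralChartInv (hb : ‖b‖ = 1) (w : (Submodule.span ℝ {b})ᗮ) :
    ‖centralChartInv b w‖ = 1 := by
  rw [centralChartInv, norm_smul, norm_inv, norm_norm,
    inv_mul_cancel₀ (norm_ne_zero_iff.2 (add_coe_ne_zero hb w))]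

theorem inner_centralChartInv_pos (hb : ‖b‖ = 1) (w : (Submodule.span ℝ {b})ᗮ) :
    0 < inner ℝ b (centralChartInv b w) := by
  rw [centralChartInv, inner_smul_right, inner_add_coe hb, mul_one]
  exact inv_pos.2 (norm_pos_iff.2 (add_coe_ne_zero hb w))

theorem centralChart_centralChartInv (hb : ‖b‖ = 1) (w : (Submodule.span ℝ {b})ᗮ) :
    centralChart b hb (centralChartInv b w) = w := by
  rw [centralChartInv, centralChart_smul hb
    (inv_ne_zero (norm_ne_zero_iff.2 (add_coe_ne_zero hb w))), centralChart, inner_add_coe hb,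
    map_add, perpPart_self, perpPart_coe, zero_add, inv_one, one_smul]

theorem add_coe_centralChart (hb : ‖b‖ = 1) {v : F} (hv : inner ℝ b v ≠ 0) :
    (b + centralChart b hb v : F) = (inner ℝ b v)⁻¹ • v := by
  rw [centralChart, Submodule.coe_smul, coe_perpPart, smul_sub, smul_smul, inv_mul_cancel₀ hv,
    one_smul]
  abel

theorem centralChartInv_centralChart (hb : ‖b‖ = 1) {v : F} (hv : 0 < inner ℝ b v) :
    centralChartInv b (centralChart b hb v) = ‖v‖⁻¹ • v := by
  rw [centralChartInv, add_coe_centralChart hb hv.ne', norm_smul, norm_inv,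
    Real.norm_of_nonneg hv.le, smul_smul, mul_inv, inv_inv, mul_right_comm, mul_inv_cancel₀ hv.ne',
    one_mul]

theorem contDiffAt_centralChart (hb : ‖b‖ = 1) {v : F} (hv : inner ℝ b v ≠ 0) :
    ContDiffAt ℝ ∞ (centralChart b hb) v := by
  have h1 : ContDiffAt ℝ ∞ (fun v : F => (inner ℝ b v)⁻¹) v :=
    ((innerSL ℝ b).contDiff.contDiffAt).inv hv
  exact h1.smul (perpPart b hb).contDiff.contDiffAt

theorem contDiff_centralChartInv (hb : ‖b‖ = 1) : ContDiff ℝ ∞ (centralChartInv b) := by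
  rw [contDiff_iff_contDiffAt]
  intro w
  have h1 : ContDiffAt ℝ ∞ (fun w : (Submodule.span ℝ {b})ᗮ => (b + w : F)) w :=
    (contDiff_const.add (Submodule.span ℝ {b})ᗮ.subtypeL.contDiff).contDiffAt
  have h0 := add_coe_ne_zero hb w
  exact ((h1.norm ℝ h0).inv (norm_ne_zero_iff.2 h0)).smul h1

theorem fderiv_centralChart (hb : ‖b‖ = 1) {u : F} (hu : inner ℝ b u ≠ 0) (v : F) :
    fderiv ℝ (centralChart b hb) u v =
      (inner ℝ b u)⁻¹ • perpPart b hb v - ((inner ℝ b u)⁻¹ * (inner ℝ b u)⁻¹ * inner ℝ b v) •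
        perpPart b hb u := by
  have h1 : HasFDerivAt (fun v : F => inner ℝ b v) (innerSL ℝ b) u := (innerSL ℝ b).hasFDerivAt
  have h2 := (hasDerivAt_inv hu).comp_hasFDerivAt u h1
  have h3 := h2.smul (perpPart b hb).hasFDerivAt
  have h4 : HasFDerivAt (centralChart b hb) _ u := h3
  rw [h4.fderiv]
  simp [sub_eq_add_neg, pow_two]

theorem fderiv_centralChart_self (hb : ‖b‖ = 1) {u : F} (hu : inner ℝ b u ≠ 0) :
    fderiv ℝ (centralChart b hb) u u = 0 := by
  rw [fderiv_centralChart hb hu, inv_mul_cancel_right₀ hu, sub_self]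

theorem fderiv_centralChart_smul_coe (hb : ‖b‖ = 1) {u : F} (hu : inner ℝ b u ≠ 0)
    (w : (Submodule.span ℝ {b})ᗮ) :
    fderiv ℝ (centralChart b hb) u (inner ℝ b u • (w : F)) = w := by
  rw [fderiv_centralChart hb hu, inner_smul_right, inner_coe_orthogonal, map_smul, perpPart_coe,
    smul_smul, inv_mul_cancel₀ hu]
  simp

theorem isDiffeoBetween_centralChart (hb : ‖b‖ = 1) :
    IsDiffeoBetween (centralChartInv b) (centralChart b hb) (ball 0 1)
      (sphere (0 : F) 1 ∩ {v | 0 < inner ℝ b v ∧ ‖centralChart b hb v‖ < 1}) where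
  mapsTo w hw := by
    refine ⟨by rw [mem_sphere_zero_iff_norm, norm_centralChartInv hb],
      inner_centralChartInv_pos hb w, ?_⟩
    rw [centralChart_centralChartInv hb]
    exact mem_ball_zero_iff.1 hw
  mapsTo_inv v hv := mem_ball_zero_iff.2 hv.2.2
  invOn := ⟨fun w _ => centralChart_centralChartInv hb w, fun v hv => by
    rw [centralChartInv_centralChart hb hv.2.1, mem_sphere_zero_iff_norm.1 hv.1, inv_one, one_smul]⟩
  contDiffOn := (contDiff_centralChartInv hb).contDiffOn
  contDiffOn_inv v hv := (contDiffAt_centralChart hb hv.2.1.ne').contDiffWithinAt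

theorem isOpen_hemisphere_centralChart (hb : ‖b‖ = 1) (R : ℝ) :
    IsOpen {v | 0 < inner ℝ b v ∧ ‖centralChart b hb v‖ < R} := by
  have h1 : IsOpen {v : F | 0 < inner ℝ b v} :=
    isOpen_lt continuous_const (innerSL ℝ b).continuous
  have h2 : ContinuousOn (fun v => ‖centralChart b hb v‖) {v : F | 0 < inner ℝ b v} := fun v hv =>
    (contDiffAt_centralChart hb (ne_of_gt hv)).continuousAt.norm.continuousWithinAt
  exact h2.isOpen_inter_preimage h1 isOpen_Iio

theorem norm_centralChart (hb : ‖b‖ = 1) {v : F} (hv : 0 < inner ℝ b v) :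
    ‖centralChart b hb v‖ = ‖perpPart b hb v‖ / inner ℝ b v := by
  rw [centralChart, norm_smul, norm_inv, Real.norm_of_nonneg hv.le, div_eq_inv_mul]

theorem norm_le_inner_add_perpPart (hb : ‖b‖ = 1) {v : F} (hv : 0 ≤ inner ℝ b v) :
    ‖v‖ ≤ inner ℝ b v + ‖perpPart b hb v‖ := by
  have : v = inner ℝ b v • b + (perpPart b hb v : F) := by rw [coe_perpPart]; abel
  calc ‖v‖ = ‖inner ℝ b v • b + (perpPart b hb v : F)‖ := by rw [← this]
    _ ≤ ‖inner ℝ b v • b‖ + ‖(perpPart b hb v : F)‖ := norm_add_le _ _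
    _ = _ := by rw [norm_smul, hb, mul_one, Real.norm_of_nonneg hv]; rfl

end CentralChart

/-! ### A conserved quantity controlling small values -/

/-- `expNegInvGlue` is injective on positive reals and zero elsewhere, so its value at `a - s`
determines `s` below `a` and only records `a ≤ s` otherwise. -/
theorem expNegInvGlue_eq_imp {a s t : ℝ} (h : expNegInvGlue (a - s) = expNegInvGlue (a - t)) :
    min t a ≤ s := by
  rcases le_or_gt a s with hs | hs
  · exact (min_le_right _ _).trans hs
  · have h1 := expNegInvGlue.pos_of_pos (sub_pos.2 hs)
    have ht : 0 < a - t := by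
      by_contra hcon
      rw [h, expNegInvGlue.zero_of_nonpos (not_lt.1 hcon)] at h1
      exact lt_irrefl _ h1
    rw [expNegInvGlue, expNegInvGlue, if_neg (sub_pos.2 hs).not_ge, if_neg ht.not_ge,
      Real.exp_eq_exp, neg_inj, inv_inj] at h
    exact (min_le_left _ _).trans (by linarith)

/-! ### The Milnor fibration on the complement of the link -/

theorem contDiffAt_milnorMap {E F : Type*} [NormedAddCommGroup E] [NormedSpace ℝ E]
    [NormedAddCommGroup F] [InnerProductSpace ℝ F] {ψ : E → F} {x : E}
    (hψ : ContDiffAt ℝ ∞ ψ x) (hx : ψ x ≠ 0) : ContDiffAt ℝ ∞ (milnorMap ψ) x :=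
  ((hψ.norm ℝ hx).inv (norm_ne_zero_iff.2 hx)).smul hψ

theorem norm_milnorMap {E F : Type*} [NormedAddCommGroup F] [NormedSpace ℝ F] {ψ : E → F} {x : E}
    (hx : ψ x ≠ 0) : ‖milnorMap ψ x‖ = 1 := by
  rw [milnorMap, norm_smul, norm_inv, norm_norm, inv_mul_cancel₀ (norm_ne_zero_iff.2 hx)]

theorem map_fderiv_centralChart_eq_top {E F : Type*} [NormedAddCommGroup E] [InnerProductSpace ℝ E]
    [NormedAddCommGroup F] [InnerProductSpace ℝ F] {ψ : E → F} {b : F} (hb : ‖b‖ = 1) {x : E}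
    (hψ : ContDiffAt ℝ ∞ ψ x) (hx : 0 < inner ℝ b (ψ x))
    (hS : ((Submodule.span ℝ {x})ᗮ).map (fderiv ℝ (milnorMap ψ) x : E →ₗ[ℝ] F) =
      (Submodule.span ℝ {milnorMap ψ x})ᗮ) :
    ((Submodule.span ℝ {x})ᗮ).map
      (fderiv ℝ (fun y => centralChart b hb (ψ y)) x : E →ₗ[ℝ] (Submodule.span ℝ {b})ᗮ) = ⊤ := by
  have hx0 : ψ x ≠ 0 := by intro h; rw [h, inner_zero_right] at hx; exact lt_irrefl _ hx
  set θ := milnorMap ψ x with hθ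
  have hθn : ‖θ‖ = 1 := norm_milnorMap hx0
  have hθb : inner ℝ b θ ≠ 0 := by
    rw [hθ, milnorMap, inner_smul_right]
    exact mul_ne_zero (inv_ne_zero (norm_ne_zero_iff.2 hx0)) hx.ne'
  have hev : (fun y => centralChart b hb (ψ y)) =ᶠ[𝓝 x]
      fun y => centralChart b hb (milnorMap ψ y) := by
    filter_upwards [hψ.continuousAt.eventually_ne hx0] with y hy
    rw [milnorMap, centralChart_smul hb (inv_ne_zero (norm_ne_zero_iff.2 hy))]
  have hcomp : HasFDerivAt (fun y => centralChart b hb (milnorMap ψ y))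
      ((fderiv ℝ (centralChart b hb) θ).comp (fderiv ℝ (milnorMap ψ) x)) x := by
    have h1 : HasFDerivAt (centralChart b hb) (fderiv ℝ (centralChart b hb) θ) (milnorMap ψ x) :=
      ((contDiffAt_centralChart hb hθb).differentiableAt (by simp)).hasFDerivAt
    exact h1.comp x ((contDiffAt_milnorMap hψ hx0).differentiableAt (by simp)).hasFDerivAt
  rw [hev.fderiv_eq, hcomp.fderiv, Submodule.eq_top_iff']
  intro w
  -- A vector mapped to `w` by the chart derivative. Removing its radial part makes it tangent to
  -- the unit sphere at `θ`, and costs nothing because the chart derivative kills `θ`.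
  set u : F := inner ℝ b θ • (w : F) with hu
  have hmem : u - inner ℝ θ u • θ ∈ (Submodule.span ℝ {θ})ᗮ := by
    rw [Submodule.mem_orthogonal_singleton_iff_inner_right, inner_sub_right,
      inner_smul_right θ θ, real_inner_self_eq_norm_sq, hθn]
    ring
  rw [← hS] at hmem
  obtain ⟨v, hv, hvu⟩ := hmem
  refine ⟨v, hv, ?_⟩
  change fderiv ℝ (centralChart b hb) θ (fderiv ℝ (milnorMap ψ) x v) = w
  have hvu' : fderiv ℝ (milnorMap ψ) x v = u - inner ℝ θ u • θ := hvu
  rw [hvu', map_sub, map_smul _ (inner ℝ θ u) θ, fderiv_centralChart_self hb hθb, smul_zero, sub_zero,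
    fderiv_centralChart_smul_coe hb hθb]

theorem contDiffAt_smul_clm {D H E : Type*} [NormedAddCommGroup D] [NormedSpace ℝ D]
    [NormedAddCommGroup H] [NormedSpace ℝ H] [NormedAddCommGroup E] [NormedSpace ℝ E]
    {f : D → ℝ} {L : D → H →L[ℝ] E} {x : D} (hf : ContDiffAt ℝ ∞ f x) (hL : ContDiffAt ℝ ∞ L x) :
    ContDiffAt ℝ ∞ (fun x => f x • L x) x :=
  hf.smul hL

/-- A horizontal field for the central projection of `ψ`, tangent to the spheres, which preserves
`⟪b, ψ⟫` where this function is small. -/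
theorem exists_horizontal_field {E F : Type} [NormedAddCommGroup E] [InnerProductSpace ℝ E]
    [FiniteDimensional ℝ E] [NormedAddCommGroup F] [InnerProductSpace ℝ F] [FiniteDimensional ℝ F]
    {ψ : E → F} {r ε η : ℝ} (hψ : ContDiffOn ℝ ∞ ψ (ball 0 r)) (hε : 0 < ε) (hεr : ε < r)
    (hη : 0 < η)
    (hT : ∀ x ∈ sphere (0 : E) ε, ψ x ≠ 0 → ‖ψ x‖ < η →
      ((Submodule.span ℝ {x})ᗮ).map (fderiv ℝ ψ x : E →ₗ[ℝ] F) = ⊤)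
    (hS : ∀ x ∈ sphere (0 : E) ε \ link ψ ε,
      ((Submodule.span ℝ {x})ᗮ).map (fderiv ℝ (milnorMap ψ) x : E →ₗ[ℝ] F) =
        (Submodule.span ℝ {milnorMap ψ x})ᗮ) {b : F} (hb : ‖b‖ = 1) :
    ∃ (O : Set E) (X : E → (Submodule.span ℝ {b})ᗮ →L[ℝ] E) (a : ℝ), 0 < a ∧ IsOpen O ∧
      ContDiffOn ℝ ∞ X O ∧ (∀ x ∈ O, x ∈ ball (0 : E) r ∧ 0 < inner ℝ b (ψ x)) ∧
      (∀ x ∈ sphere (0 : E) ε, 0 < inner ℝ b (ψ x) → ‖centralChart b hb (ψ x)‖ ≤ 1 → x ∈ O) ∧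
      (∀ x ∈ O, ∀ w, inner ℝ x (X x w) = 0) ∧
      (∀ x ∈ O, ∀ w, fderiv ℝ (fun y => centralChart b hb (ψ y)) x (X x w) = w) ∧
      ∀ x ∈ O, inner ℝ b (ψ x) ≤ a → ∀ w, inner ℝ b (fderiv ℝ ψ x (X x w)) = 0 := by
  set q : E → (Submodule.span ℝ {b})ᗮ := fun y => centralChart b hb (ψ y) with hq
  set ρ : E → ℝ := fun x => inner ℝ b (ψ x) with hρ
  have hball : IsOpen (ball (0 : E) r \ {0}) := isOpen_ball.sdiff isClosed_singleton
  have hψ' : ContDiffOn ℝ ∞ ψ (ball (0 : E) r \ {0}) := hψ.mono sdiff_subset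
  have hρs : ContDiffOn ℝ ∞ ρ (ball (0 : E) r \ {0}) := (innerSL ℝ b).contDiff.comp_contDiffOn hψ'
  set W : Set E := (ball (0 : E) r \ {0}) ∩ ρ ⁻¹' Ioi 0 with hW
  have hWo : IsOpen W := hρs.continuousOn.isOpen_inter_preimage hball isOpen_Ioi
  have hψW : ContDiffOn ℝ ∞ ψ W := hψ'.mono inter_subset_left
  have hρW : ContDiffOn ℝ ∞ ρ W := hρs.mono inter_subset_left
  have hψx : ∀ x ∈ W, ContDiffAt ℝ ∞ ψ x := fun x hx => hψW.contDiffAt (hWo.mem_nhds hx)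
  have hqx : ∀ x ∈ W, ContDiffAt ℝ ∞ q x := fun x hx =>
    (contDiffAt_centralChart hb (ne_of_gt hx.2)).comp x (hψx x hx)
  have hqW : ContDiffOn ℝ ∞ q W := fun x hx => (hqx x hx).contDiffWithinAt
  have h0W : (0 : E) ∉ W := fun h => h.1.2 rfl
  obtain ⟨hO₁, L₁, hL₁, hL₁x, hL₁q⟩ := exists_tangent_rightInverse hWo h0W hqW
  obtain ⟨hO₂, L₂, hL₂, hL₂x, hL₂ψ⟩ := exists_tangent_rightInverse hWo h0W hψW
  set O₁ := {x ∈ W | ((Submodule.span ℝ {x})ᗮ).map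
    (fderiv ℝ q x : E →ₗ[ℝ] (Submodule.span ℝ {b})ᗮ) = ⊤} with hO₁def
  set O₂ := {x ∈ W | ((Submodule.span ℝ {x})ᗮ).map (fderiv ℝ ψ x : E →ₗ[ℝ] F) = ⊤} with hO₂def
  -- Where the chart value has norm at most `1`, `‖ψ‖ ≤ 2ρ`. So `ρ ≤ 2a` forces `‖ψ‖ ≤ 4a = η / 2 <
  -- η`, inside the tube where `ψ` is a submersion.
  set a := η / 8 with ha
  have hapos : 0 < a := by positivity
  let χ : E → ℝ := fun x => Real.smoothTransition ((2 * a - ρ x) / a)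
  have hχ : ContDiffOn ℝ ∞ χ W :=
    Real.smoothTransition.contDiff.comp_contDiffOn ((contDiffOn_const.sub hρW).div_const a)
  have hχ1 : ∀ x, ρ x ≤ a → χ x = 1 := fun x hx =>
    Real.smoothTransition.one_of_one_le (by rw [le_div_iff₀ hapos]; linarith)
  have hχ0 : ∀ x, 2 * a ≤ ρ x → χ x = 0 := fun x hx =>
    Real.smoothTransition.zero_of_nonpos (div_nonpos_of_nonpos_of_nonneg (by linarith) hapos.le)
  -- Both terms lift the chart value: moving `ψ` by `ρ w` moves its central projection by `w`, and
  -- fixes `ρ` since `w ⟂ b`. Hence so does their convex combination, which is the first lift alone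
  -- for `ρ ≤ a` and `L₁` alone for `ρ ≥ 2a`.
  let X : E → (Submodule.span ℝ {b})ᗮ →L[ℝ] E := fun x =>
    (χ x * ρ x) • (L₂ x).comp (Submodule.span ℝ {b})ᗮ.subtypeL + (1 - χ x) • L₁ x
  have hX : ∀ x w, X x w = χ x • L₂ x (ρ x • (w : F)) + (1 - χ x) • L₁ x w := fun x w => by
    rw [map_smul, smul_smul]; rfl
  have hO₃ : IsOpen (W ∩ ρ ⁻¹' Ioi (2 * a)) :=
    hρW.continuousOn.isOpen_inter_preimage hWo isOpen_Ioi
  have hcase : ∀ x ∈ O₁ ∩ (O₂ ∪ (W ∩ ρ ⁻¹' Ioi (2 * a))), χ x = 0 ∨ x ∈ O₂ := by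
    rintro x ⟨-, hx | hx⟩
    · exact Or.inr hx
    · exact Or.inl (hχ0 x (le_of_lt hx.2))
  have hqψ : ∀ x ∈ W, ∀ v, fderiv ℝ q x v = fderiv ℝ (centralChart b hb) (ψ x) (fderiv ℝ ψ x v) := by
    intro x hx v
    have : HasFDerivAt q ((fderiv ℝ (centralChart b hb) (ψ x)).comp (fderiv ℝ ψ x)) x :=
      HasFDerivAt.comp x
        ((contDiffAt_centralChart hb (ne_of_gt hx.2)).differentiableAt (by simp)).hasFDerivAt
        ((hψx x hx).differentiableAt (by simp)).hasFDerivAt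
    rw [this.fderiv]; rfl
  refine ⟨O₁ ∩ (O₂ ∪ (W ∩ ρ ⁻¹' Ioi (2 * a))), X, a, hapos, hO₁.inter (hO₂.union hO₃), ?_, ?_, ?_,
    ?_, ?_, ?_⟩
  · have hL₁' : ∀ x ∈ O₁, ContDiffAt ℝ ∞ L₁ x := fun x hx => hL₁.contDiffAt (hO₁.mem_nhds hx)
    have hχ' : ∀ x ∈ O₁, ContDiffAt ℝ ∞ χ x := fun x hx => hχ.contDiffAt (hWo.mem_nhds hx.1)
    have hsnd : ∀ x ∈ O₁, ContDiffAt ℝ ∞ (fun x => (1 - χ x) • L₁ x) x := fun x hx =>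
      contDiffAt_smul_clm (contDiffAt_const.sub (hχ' x hx)) (hL₁' x hx)
    rintro x ⟨hx₁, hx | hx⟩
    · have h1 : ContDiffAt ℝ ∞ (fun x => (L₂ x).comp (Submodule.span ℝ {b})ᗮ.subtypeL) x :=
        (hL₂.contDiffAt (hO₂.mem_nhds hx)).clm_comp contDiffAt_const
      have h2 : ContDiffAt ℝ ∞ (fun x => χ x * ρ x) x :=
        (hχ' x hx₁).mul (hρW.contDiffAt (hWo.mem_nhds hx₁.1))
      exact ((contDiffAt_smul_clm h2 h1).add (hsnd x hx₁)).contDiffWithinAt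
    · refine ((hsnd x hx₁).congr_of_eventuallyEq ?_).contDiffWithinAt
      filter_upwards [hO₃.mem_nhds hx] with y hy
      simp [X, hχ0 y (le_of_lt hy.2)]
  · rintro x ⟨hx, -⟩
    exact ⟨hx.1.1.1, hx.1.2⟩
  · intro x hx hρx hqn
    have hxr : x ∈ ball (0 : E) r \ {0} := by
      rw [mem_sphere_zero_iff_norm] at hx
      refine ⟨by rw [mem_ball_zero_iff, hx]; exact hεr, ?_⟩
      rintro rfl
      rw [norm_zero] at hx
      exact hε.ne hx
    have hxW : x ∈ W := ⟨hxr, hρx⟩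
    have hψ0 : ψ x ≠ 0 := by intro h; simp [h] at hρx
    refine ⟨⟨hxW, map_fderiv_centralChart_eq_top hb (hψx x hxW) hρx
      (hS x ⟨hx, fun h => hψ0 h.2⟩)⟩, ?_⟩
    rcases lt_or_ge (2 * a) (ρ x) with h | h
    · exact Or.inr ⟨hxW, h⟩
    · refine Or.inl ⟨hxW, hT x hx hψ0 ?_⟩
      rw [norm_centralChart hb hρx, div_le_one hρx] at hqn
      have h1 := norm_le_inner_add_perpPart hb hρx.le
      have h2 : inner ℝ b (ψ x) ≤ 2 * a := h
      linarith
  · rintro x hx w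
    rw [hX, inner_add_right, inner_smul_right, inner_smul_right, hL₁x x hx.1.1, hL₂x x hx.1.1]
    simp
  · intro x hx w
    have h1 : fderiv ℝ q x (L₁ x w) = w := hL₁q x hx.1.1 hx.1.2 w
    rw [hX, map_add, map_smul _ (χ x), map_smul _ (1 - χ x), h1]
    rcases hcase x hx with h | h
    · rw [h]; simp
    · rw [hqψ x hx.1.1, hL₂ψ x hx.1.1 h.2, fderiv_centralChart_smul_coe hb (ne_of_gt hx.1.1.2),
        ← add_smul]
      simp
  · intro x hx hxa w
    have hx₂ : x ∈ O₂ := by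
      rcases hx.2 with h | h
      · exact h
      · have h1 : 2 * a < inner ℝ b (ψ x) := h.2
        linarith
    rw [hX, hχ1 x hxa, sub_self, zero_smul, add_zero, one_smul, hL₂ψ x hx.1.1 hx₂.2,
      inner_smul_right, inner_coe_orthogonal, mul_zero]

/-- The Milnor map is a fibration, if it is a submersion and `ψ` is a submersion near the link. -/
theorem isSmoothFibration_milnorMap {E F : Type} [NormedAddCommGroup E] [InnerProductSpace ℝ E]
    [FiniteDimensional ℝ E] [NormedAddCommGroup F] [InnerProductSpace ℝ F] [FiniteDimensional ℝ F]
    {ψ : E → F} {r ε η : ℝ} (hψ : ContDiffOn ℝ ∞ ψ (ball 0 r)) (hε : 0 < ε) (hεr : ε < r)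
    (hη : 0 < η)
    (hT : ∀ x ∈ sphere (0 : E) ε, ψ x ≠ 0 → ‖ψ x‖ < η →
      ((Submodule.span ℝ {x})ᗮ).map (fderiv ℝ ψ x : E →ₗ[ℝ] F) = ⊤)
    (hS : ∀ x ∈ sphere (0 : E) ε \ link ψ ε,
      ((Submodule.span ℝ {x})ᗮ).map (fderiv ℝ (milnorMap ψ) x : E →ₗ[ℝ] F) =
        (Submodule.span ℝ {milnorMap ψ x})ᗮ) :
    IsSmoothFibration (milnorMap ψ) (sphere (0 : E) ε \ link ψ ε) (sphere (0 : F) 1) := by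
  have hSr : sphere (0 : E) ε ⊆ ball 0 r := fun x hx => by
    rw [mem_sphere_zero_iff_norm] at hx
    rw [mem_ball_zero_iff, hx]; exact hεr
  have hψx : ∀ x ∈ ball (0 : E) r, ContDiffAt ℝ ∞ ψ x := fun x hx =>
    hψ.contDiffAt (isOpen_ball.mem_nhds hx)
  have hne : ∀ x ∈ sphere (0 : E) ε \ link ψ ε, ψ x ≠ 0 := fun x hx h => hx.2 ⟨hx.1, h⟩
  refine ⟨fun x hx => mem_sphere_zero_iff_norm.2 (norm_milnorMap (hne x hx)), fun x hx =>
    (contDiffAt_milnorMap (hψx x (hSr hx.1)) (hne x hx)).contDiffWithinAt, fun b hb => ?_⟩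
  replace hb : ‖b‖ = 1 := mem_sphere_zero_iff_norm.1 hb
  obtain ⟨O, X, a, ha, hO, hX, hOr, hSO, hXx, hXq, hXψ⟩ :=
    exists_horizontal_field hψ hε hεr hη hT hS hb
  set q : E → (Submodule.span ℝ {b})ᗮ := fun y => centralChart b hb (ψ y) with hq
  set ρ : E → ℝ := fun x => inner ℝ b (ψ x) with hρ
  set U : Set F := {v | 0 < inner ℝ b v ∧ ‖centralChart b hb v‖ < 1} with hU
  have hρd : ∀ x ∈ O, HasFDerivAt ρ ((innerSL ℝ b).comp (fderiv ℝ ψ x)) x := fun x hx =>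
    (innerSL ℝ b).hasFDerivAt.comp x
      ((hψx x (hOr x hx).1).differentiableAt (by simp)).hasFDerivAt
  have hqO : ContDiffOn ℝ ∞ q O := fun x hx =>
    ((contDiffAt_centralChart hb (ne_of_gt (hOr x hx).2)).comp x
      (hψx x (hOr x hx).1)).contDiffWithinAt
  -- The second component sees `ρ` only below `a`, where the field preserves `ρ`; for `ρ > a` it is
  -- locally constant. Thus it is conserved everywhere.
  let κ : E → ℝ × ℝ := fun x => (‖x‖ ^ 2, expNegInvGlue (a - ρ x))
  have hn2 : ∀ x : E, HasFDerivAt (fun x : E => ‖x‖ ^ 2) (2 • innerSL ℝ x) x := fun x => by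
    simpa using (hasFDerivAt_id x).norm_sq
  have hgd : ∀ x ∈ O, HasFDerivAt (fun x => expNegInvGlue (a - ρ x))
      (deriv expNegInvGlue (a - ρ x) • -(innerSL ℝ b).comp (fderiv ℝ ψ x)) x := fun x hx =>
    HasDerivAt.comp_hasFDerivAt x
      ((expNegInvGlue.contDiff (n := 1)).differentiable (by simp) _).hasDerivAt
      ((hρd x hx).const_sub a)
  have hκd : ∀ x ∈ O, HasFDerivAt κ _ x := fun x hx => (hn2 x).prodMk (hgd x hx)
  have hκX : ∀ x ∈ O, ∀ w, fderiv ℝ κ x (X x w) = 0 := by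
    intro x hx w
    rw [(hκd x hx).fderiv]
    refine Prod.ext ?_ ?_
    · simp [hXx x hx w]
    · rcases le_or_gt (ρ x) a with h | h
      · simp [hXψ x hx h w]
      · have h1 : expNegInvGlue =ᶠ[𝓝 (a - ρ x)] fun _ => 0 := by
          filter_upwards [Iio_mem_nhds (sub_neg.2 h)] with t ht
          exact expNegInvGlue.zero_of_nonpos (le_of_lt ht)
        simp [h1.deriv_eq]
  set M : Set E := (sphere (0 : E) ε \ link ψ ε) ∩ milnorMap ψ ⁻¹' U with hMdef
  have hMS : ∀ x, x ∈ M ↔ x ∈ sphere (0 : E) ε ∧ 0 < ρ x ∧ ‖q x‖ < 1 := by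
    intro x
    have key : ψ x ≠ 0 → (milnorMap ψ x ∈ U ↔ 0 < ρ x ∧ ‖q x‖ < 1) := fun h => by
      have hpos : 0 < ‖ψ x‖⁻¹ := inv_pos.2 (norm_pos_iff.2 h)
      simp only [hU, milnorMap, mem_ofPred_eq, inner_smul_right, centralChart_smul hb hpos.ne', hq,
        hρ, mul_pos_iff_of_pos_left hpos]
    constructor
    · rintro ⟨hx, hxU⟩
      exact ⟨hx.1, (key (hne x hx)).1 hxU⟩
    · rintro ⟨hx, hx'⟩
      have h0 : ψ x ≠ 0 := by
        intro h
        have := hx'.1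
        simp [hρ, h] at this
      exact ⟨⟨hx, fun h => h0 h.2⟩, (key h0).2 hx'⟩
  have hM : M = {x ∈ O | κ x ∈ ({ε ^ 2} ×ˢ univ : Set (ℝ × ℝ)) ∧ ‖q x‖ < 1} := by
    ext x
    rw [hMS]
    constructor
    · rintro ⟨hx, hx1, hx2⟩
      exact ⟨hSO x hx hx1 hx2.le, ⟨by simp [κ, mem_sphere_zero_iff_norm.1 hx], mem_univ _⟩, hx2⟩
    · rintro ⟨hx, ⟨hx1, -⟩, hx2⟩
      refine ⟨?_, (hOr x hx).2, hx2⟩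
      rw [mem_sphere_zero_iff_norm]
      exact (pow_left_inj₀ (norm_nonneg _) hε.le two_ne_zero).1 hx1
  have hψS : ContinuousOn ψ (sphere (0 : E) ε) := hψ.continuousOn.mono hSr
  have hρS : ContinuousOn ρ (sphere (0 : E) ε) := (innerSL ℝ b).continuous.comp_continuousOn hψS
  have hproper : ∀ x₀ ∈ M, ∃ V ∈ 𝓝 x₀, ∃ Z, IsCompact Z ∧ Z ⊆ O ∧
      ∀ x ∈ M ∩ V, ∀ y ∈ O, κ y = κ x → ‖q y‖ < 1 → y ∈ Z := by
    intro x₀ hx₀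
    have hx₀' := (hMS x₀).1 hx₀
    have hx₀O : x₀ ∈ O := hSO x₀ hx₀'.1 hx₀'.2.1 hx₀'.2.2.le
    -- For `x` near `x₀`, conservation of `κ` gives `min (ρ x) a ≤ ρ y`, so `ρ ≥ c` along its level.
    -- The compact set adds chart norm at most `1`, written without division so that the condition
    -- is closed on the whole sphere.
    set c := min (ρ x₀ / 2) a with hc
    have hcpos : 0 < c := lt_min (half_pos hx₀'.2.1) ha
    refine ⟨{x | ρ x₀ / 2 < ρ x},
      (hρd x₀ hx₀O).continuousAt.eventually_const_lt (half_lt_self hx₀'.2.1),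
      (sphere (0 : E) ε ∩ ρ ⁻¹' Ici c) ∩
        (sphere (0 : E) ε ∩ (fun x => ‖perpPart b hb (ψ x)‖ - ρ x) ⁻¹' Iic 0), ?_, ?_, ?_⟩
    · have hcl := isClosed_sphere (x := (0 : E)) (ε := ε)
      refine (isCompact_sphere (0 : E) ε).of_isClosed_subset
        ((hρS.preimage_isClosed_of_isClosed hcl isClosed_Ici).inter
          (ContinuousOn.preimage_isClosed_of_isClosed ?_ hcl isClosed_Iic))
        (inter_subset_left.trans inter_subset_left)
      exact ((perpPart b hb).continuous.comp_continuousOn hψS).norm.sub hρS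
    · rintro x ⟨⟨hx, hx1⟩, -, hx2⟩
      have hρx : 0 < ρ x := hcpos.trans_le hx1
      refine hSO x hx hρx ?_
      rw [norm_centralChart hb hρx, div_le_one hρx]
      exact sub_nonpos.1 hx2
    · rintro x ⟨hx, hxV⟩ y hy hxy hqy
      have hx' := (hMS x).1 hx
      have h1 : ‖y‖ ^ 2 = ‖x‖ ^ 2 := congrArg Prod.fst hxy
      have h2 : min (ρ x) a ≤ ρ y := expNegInvGlue_eq_imp (congrArg Prod.snd hxy)
      have hyS : y ∈ sphere (0 : E) ε := by
        rw [mem_sphere_zero_iff_norm, ← mem_sphere_zero_iff_norm.1 hx'.1]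
        exact (pow_left_inj₀ (norm_nonneg _) (norm_nonneg _) two_ne_zero).1 h1
      have hρy : 0 < ρ y := (hOr y hy).2
      refine ⟨⟨hyS, ?_⟩, hyS, ?_⟩
      · exact (min_le_min_right a (le_of_lt hxV)).trans h2
      · have h3 : ‖q y‖ < 1 := hqy
        rw [hq, norm_centralChart hb hρy, div_lt_one hρy] at h3
        exact sub_nonpos.2 h3.le
  obtain ⟨Φ, Ψ, hΦ, hfst, -⟩ := exists_isDiffeoBetween_of_horizontal hO hX hqO
    (fun x hx => (hκd x hx).differentiableAt) hXq hκX hM hproper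
  have hθq : ∀ x ∈ M, centralChartInv b (q x) = milnorMap ψ x := fun x hx =>
    centralChartInv_centralChart hb ((hMS x).1 hx).2.1
  have hbU : b ∈ U := by
    refine ⟨?_, ?_⟩
    · rw [real_inner_self_eq_norm_sq, hb]; norm_num
    · rw [centralChart_self, norm_zero]; exact one_pos
  have hfib : M ∩ q ⁻¹' {0} = (sphere (0 : E) ε \ link ψ ε) ∩ milnorMap ψ ⁻¹' {b} := by
    ext x
    constructor
    · rintro ⟨hx, hqx⟩
      refine ⟨hx.1, ?_⟩
      rw [mem_preimage, mem_singleton_iff] at hqx ⊢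
      rw [← hθq x hx, hqx, centralChartInv]
      simp [hb]
    · rintro ⟨hx, hθx⟩
      rw [mem_preimage, mem_singleton_iff] at hθx
      refine ⟨⟨hx, by rw [mem_preimage, hθx]; exact hbU⟩, ?_⟩
      change centralChart b hb (ψ x) = 0
      have := centralChart_smul hb (inv_ne_zero (norm_ne_zero_iff.2 (hne x hx))) (ψ x)
      change centralChart b hb (milnorMap ψ x) = _ at this
      rw [← this, hθx, centralChart_self]
  rw [hfib] at hΦ
  refine ⟨U, isOpen_hemisphere_centralChart hb 1, hbU, _, _,
    hΦ.comp_fst (isDiffeoBetween_centralChart hb), fun x hx => ?_⟩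
  simp only [hfst x hx]
  exact hθq x hx

/-! ### The open book -/

theorem one_lt_rank_euclideanSpace {n : ℕ} (hn : 2 ≤ n) :
    1 < Module.rank ℝ (EuclideanSpace ℝ (Fin n)) := by
  rw [← Module.finrank_eq_rank, finrank_euclideanSpace_fin]
  exact_mod_cast hn

theorem proposition5p3 (m p : ℕ) (hp : 2 ≤ p) (hpm : p < m)
    (ψ : EuclideanSpace ℝ (Fin m) → EuclideanSpace ℝ (Fin p))
    (hψ : AnalyticAt ℝ ψ 0) (hψ0 : ψ 0 = 0)
    (hne : ∃ᶠ x in 𝓝 (0 : EuclideanSpace ℝ (Fin m)), ψ x ≠ 0)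
    (hcrit : HasIsolatedCriticalValue ψ)
    (htube : HasThinTubeFibration ψ)
    (hsubm : MilnorMapIsSubmersion ψ) :
    ∀ᶠ ε in 𝓝[>] (0 : ℝ),
      IsSingularOpenBook (sphere (0 : EuclideanSpace ℝ (Fin m)) ε) (link ψ ε) (milnorMap ψ) ∧
      (LinkIsRegular ψ ε →
        IsOpenBook (sphere (0 : EuclideanSpace ℝ (Fin m)) ε) (link ψ ε) (milnorMap ψ)) := by
  obtain ⟨r, hr, hA⟩ := Metric.eventually_nhds_iff_ball.1 hψ.eventually_analyticAt
  have hsm : ContDiffOn ℝ ∞ ψ (ball 0 r) := fun x hx => (hA x hx).contDiffAt.contDiffWithinAt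
  filter_upwards [hsubm, htube, eventually_exists_sphere_ne_zero hψ hψ0 hne,
    Ioo_mem_nhdsGT hr] with ε hS htubeε hnz hεr
  obtain ⟨hε, hεr⟩ := hεr
  -- A single admissible tube radius suffices from here on.
  obtain ⟨η, htubeη, hη⟩ := (htubeε.and self_mem_nhdsWithin).exists
  replace hη : 0 < η := hη
  have hSr : sphere (0 : EuclideanSpace ℝ (Fin m)) ε ⊆ ball 0 r := fun x hx => by
    rw [mem_sphere_zero_iff_norm] at hx
    rw [mem_ball_zero_iff, hx]; exact hεr
  have hcont : ContinuousOn ψ (ball 0 r) := hsm.continuousOn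
  have hψS : ContinuousOn ψ (sphere (0 : EuclideanSpace ℝ (Fin m)) ε) := hcont.mono hSr
  have hT : ∀ x ∈ sphere (0 : EuclideanSpace ℝ (Fin m)) ε, ψ x ≠ 0 → ‖ψ x‖ < η →
      ((Submodule.span ℝ {x})ᗮ).map (fderiv ℝ ψ x : _ →ₗ[ℝ] EuclideanSpace ℝ (Fin p)) = ⊤ := by
    intro x hx hx0 hxη
    refine htubeη.map_fderiv_eq_top inter_subset_left
      ⟨hx, mem_closedBall_zero_iff.2 hxη.le, hx0⟩ ?_ (hA x (hSr hx)).differentiableAt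
    exact mem_of_superset ((isOpen_ball.sdiff isClosed_singleton).mem_nhds
      ⟨mem_ball_zero_iff.2 hxη, hx0⟩) (sdiff_subset_sdiff_left ball_subset_closedBall)
  have hfib := isSmoothFibration_milnorMap hsm hε hεr hη hT hS
  have hsurj : SurjOn (milnorMap ψ) (sphere 0 ε \ link ψ ε) (sphere 0 1) := by
    obtain ⟨x, hx, hx0⟩ := hnz
    exact hfib.surjOn (isPreconnected_sphere (one_lt_rank_euclideanSpace hp) 0 1)
      ⟨x, hx, fun h => hx0 h.2⟩
  have hclosed : IsClosed (link ψ ε) :=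
    hψS.preimage_isClosed_of_isClosed isClosed_sphere isClosed_singleton
  have hnbhd : ∀ δ : ℝ, 0 < δ → IsOpen (ball 0 r ∩ ψ ⁻¹' ball 0 δ) ∧ link ψ ε ⊆ ball 0 r ∩ ψ ⁻¹' ball 0 δ ∧
      sphere 0 ε ∩ (ball 0 r ∩ ψ ⁻¹' ball 0 δ) = sphere 0 ε ∩ {x | ‖ψ x‖ < δ} := by
    intro δ hδ
    refine ⟨hcont.isOpen_inter_preimage isOpen_ball isOpen_ball, fun x hx => ⟨hSr hx.1, ?_⟩, ?_⟩
    · have : ψ x = 0 := hx.2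
      rw [mem_preimage, this]
      exact mem_ball_self hδ
    · ext x
      simp only [mem_inter_iff, mem_preimage, mem_ball_zero_iff, mem_ofPred_eq]
      exact ⟨fun h => ⟨h.1, h.2.2⟩, fun h => ⟨h.1, mem_ball_zero_iff.1 (hSr h.1), h.2⟩⟩
  have hnormalize : ∀ δ : ℝ, 0 < δ → ∀ x, milnorMap ψ x = ‖δ⁻¹ • ψ x‖⁻¹ • δ⁻¹ • ψ x := by
    intro δ hδ x
    rw [milnorMap, norm_smul, norm_inv, Real.norm_of_nonneg (le_of_lt hδ), mul_inv, inv_inv,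
      smul_smul, mul_right_comm, mul_inv_cancel₀ (ne_of_gt hδ), one_mul]
  refine ⟨⟨inter_subset_left, hclosed, hfib, hsurj, ?_⟩, fun hreg =>
    ⟨inter_subset_left, hclosed, hfib, hsurj, ?_⟩⟩
  · obtain ⟨hNo, hKN, hSN⟩ := hnbhd η hη
    have hpunct : (sphere 0 ε ∩ {x | ‖ψ x‖ < η}) \ link ψ ε =
        sphere 0 ε ∩ ψ ⁻¹' (ball 0 η \ {0}) := by
      ext x
      simp only [link, Set.mem_sdiff, mem_inter_iff, mem_preimage, mem_ball_zero_iff, mem_ofPred_eq,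
        mem_singleton_iff]
      tauto
    have hh := htubeη.rescale hη
    refine ⟨ball 0 r ∩ ψ ⁻¹' ball 0 η, fun x => η⁻¹ • ψ x, hNo, hKN, ?_⟩
    rw [hSN, hpunct]
    refine ⟨?_, fun x hx => ?_, hh, ?_, fun x _ => hnormalize η hη x⟩
    · exact (hψS.mono inter_subset_left).const_smul η⁻¹
    · rw [smul_eq_zero_iff_right (inv_ne_zero hη.ne')]
      exact ⟨fun h => ⟨hx.1, h⟩, fun h => h.2⟩
    -- The sphere is connected and carries both a zero and a nonzero value of `ψ`, so the punctured
    -- tube is nonempty; connectedness of the punctured ball does the rest.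
    · rintro ⟨x, hx⟩
      obtain ⟨y, hy, hy0⟩ := hnz
      obtain ⟨z, hz, hz0, hzη⟩ := (isPreconnected_sphere (one_lt_rank_euclideanSpace
        (hp.trans hpm.le)) 0 ε).exists_norm_lt_ne_zero hψS hx.1 hy hx.2 hy0 hη
      exact hh.surjOn (isPreconnected_punctured_ball (one_lt_rank_euclideanSpace hp))
        ⟨z, hz, mem_ball_zero_iff.2 hzη, hz0⟩
  · obtain ⟨δ, hδ, Φ, Ψ, hΦ, hfst, hzero⟩ := hreg.exists_tube hsm hε hεr
    obtain ⟨hNo, hKN, hSN⟩ := hnbhd δ hδ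
    refine ⟨ball 0 r ∩ ψ ⁻¹' ball 0 δ, Φ, Ψ, hNo, hKN, ?_⟩
    rw [hSN]
    refine ⟨hΦ, hzero, fun x hx => ?_⟩
    rw [hfst x hx.1]
    exact hnormalize δ hδ x
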